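/- Let $d\ge 1$, $Y=[0,2\pi)^d$, $Y'=[-\tfrac12,\tfrac12)^d$. Let $A=(a_{jk})$ be a symmetric matrix of real, measurable, $2\pi\mathbb{Z}^d$-periodic functions on $\mathbb{R}^d$ with $|a_{jk}|\le\beta$ and $A(y)\zeta\cdot\zeta\ge\alpha|\zeta|^2$ for a.e. $y$ and all $\zeta\in\mathbb{R}^d$, where $\alpha>0$. For $\rho>0$ and $\eta\in Y'$ let $\lambda_1^\rho(\eta)\le\lambda_2^\rho(\eta)\le\dots$ be the eigenvalues, counted with multiplicity, of $$\rho^2(\nabla+i\eta)^4\phi-(\nabla+i\eta)\cdot A(\nabla+i\eta)\phi=\lambda\phi$$ (in the weak sense, on $Y$-periodic $H^2$ functions), and let $\phi_m^\rho(\cdot;\eta)$, $m\ge1$, be corresponding eigenfunctions, chosen measurably in $\eta$ and forming an orthonormal basis of $L^2(Y)$. For $\kappa,\epsilon>0$ put $\rho=\kappa/\epsilon$ and $\phi_m^{\kappa,\epsilon}(x;\xi)=\phi_m^\rho(x/\epsilon;\epsilon\xi)$ for $\xi\in\epsilon^{-1}Y'$, and for $g\in L^2(\mathbb{R}^d)$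 let $$\mathcal{B}_m^{\kappa,\epsilon}g(\xi)=\int_{\mathbb{R}^d}g(x)e^{-ix\cdot\xi}\,\overline{\phi_m^{\kappa,\epsilon}(x;\xi)}\,dx,$$ the integral being the limit in $L^2(\epsilon^{-1}Y')$ as $R\to\infty$ of the integrals over $\{|x|<R\}$. Proposition 8.1 (Contribution of higher modes). For every $M$ there is a constant $c>0$, depending only on $d,\alpha,\beta,M$ (and not on $\epsilon,\kappa$), such that the following holds for all $A$ as above and all $\epsilon,\kappa>0$. Let $f\in L^2(\mathbb{R}^d)$ and let $u^\epsilon\in H^2(\mathbb{R}^d)$ satisfy $$\kappa^2\Delta^2u^\epsilon-\nabla\cdot A(x/\epsilon)\nabla u^\epsilon=f\quad\text{in }\mathbb{R}^d,\qquad \|u^\epsilon\|_{H^1(\mathbb{R}^d)}\le M,\quad \kappa\|\Delta u^\epsilon\|_{L^2(\mathbb{R}^d)}\le M.$$ Then the Bloch coefficients $\mathcal{B}_m^{\kappa,\epsilon}u^\epsilon$, $m\ge 1$, exist, the series $$v^{\kappa,\epsilon}(x)=\int_{\epsilon^{-1}Y'}\sum_{m=2}^\infty\mathcal{B}_m^{\kappa,\epsilon}u^\epsilon(\xi)\,\phi_m^{\kappa,\epsilon}(x;\xi)\,e^{ix\cdot\xi}\,d\xi$$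 converges (its partial sums converge in $L^2(\mathbb{R}^d)$), and $$\|v^{\kappa,\epsilon}\|_{L^2(\mathbb{R}^d)}\le c\,\epsilon .$$ -/

import Mathlib

open MeasureTheory Filter Topology ComplexConjugate
open scoped ENNReal SchwartzMap LineDeriv Laplacian TemperedDistribution

namespace BlochHom

noncomputable section

/-- Euclidean space `ℝ^d`. -/
abbrev E (d : ℕ) : Type := EuclideanSpace ℝ (Fin d)

/-- The complex Lebesgue space `L²(ℝ^d)`. -/
abbrev L2 (d : ℕ) : Type := Lp ℂ 2 (volume : Measure (E d))

/-! ### Coefficients -/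

/-- `A` has real, measurable entries bounded by `β`; it is elliptic with constant `α > 0`, periodic
with period `2π` in each coordinate, and symmetric. -/
structure IsAdmissible {d : ℕ} (α β : ℝ) (A : E d → Matrix (Fin d) (Fin d) ℝ) : Prop where
  measurable : ∀ j k, AEMeasurable (fun y => A y j k) volume
  bounded : ∀ᵐ y, ∀ j k, |A y j k| ≤ β
  pos : 0 < α
  elliptic : ∀ᵐ y, ∀ ζ : Fin d → ℝ, α * ∑ j, ζ j ^ 2 ≤ ∑ j, ∑ k, A y j k * ζ k * ζ j
  periodic : ∀ p : Fin d → ℤ,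
    ∀ᵐ y, A (y + WithLp.toLp 2 (fun j => 2 * Real.pi * (p j : ℝ))) = A y
  symm : ∀ᵐ y, (A y).IsSymm

/-! ### The equation on the whole space -/

/-- `g ∈ L²` is the distributional partial derivative `∂u/∂x_j` of `u ∈ L²`. -/
def IsPartial {d : ℕ} (j : Fin d) (u g : L2 d) : Prop :=
  (g : 𝓢'(E d, ℂ)) = ∂_{EuclideanSpace.single j (1 : ℝ)} (u : 𝓢'(E d, ℂ))

/-- `g ∈ L²` is the distributional Laplacian of `u ∈ L²`. -/
def IsLaplacian {d : ℕ} (u g : L2 d) : Prop :=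
  (g : 𝓢'(E d, ℂ)) = Δ (u : 𝓢'(E d, ℂ))

/-- `u ∈ H²(ℝ^d)` solves `κ² Δ² u - ∇ · A(x/ε) ∇u = f` in `ℝ^d` in the sense of distributions.
Here `G` is the gradient of `u` and `F` is the flux `A(x/ε) ∇u`. -/
def IsSolution {d : ℕ} (A : E d → Matrix (Fin d) (Fin d) ℝ) (κ ε : ℝ) (f u : L2 d) : Prop :=
  TemperedDistribution.MemSobolev 2 2 (u : 𝓢'(E d, ℂ)) ∧
  ∃ G F : Fin d → L2 d,
    (∀ j, IsPartial j u (G j)) ∧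
    (∀ j, ∀ᵐ x, F j x = ∑ k, (A (ε⁻¹ • x) j k : ℂ) * G k x) ∧
    ((κ : ℂ) ^ 2) • Δ (Δ (u : 𝓢'(E d, ℂ)))
        - ∑ j, ∂_{EuclideanSpace.single j (1 : ℝ)} (F j : 𝓢'(E d, ℂ))
      = (f : 𝓢'(E d, ℂ))

/-! ### Periodic functions -/

/-- The periodicity cell `Y = [0, 2π)^d`. -/
def cell (d : ℕ) : Set (E d) := {y | ∀ j, y j ∈ Set.Ico 0 (2 * Real.pi)}

/-- The dual cell `Y' = [-1/2, 1/2)^d`. -/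
def dualCell (d : ℕ) : Set (E d) := {η | ∀ j, η j ∈ Set.Ico (-(1 / 2) : ℝ) (1 / 2)}

/-- The exponential `y ↦ e^{i n · y}`. -/
def expMode {d : ℕ} (n : Fin d → ℤ) (y : E d) : ℂ :=
  Complex.exp (Complex.I * ((∑ j, (n j : ℝ) * y j : ℝ) : ℂ))

theorem volume_cell_lt_top (d : ℕ) : (volume : Measure (E d)) (cell d) < ⊤ := by
  refine lt_of_le_of_lt (measure_mono (t := Metric.closedBall (0 : E d)
    (Real.sqrt (∑ _j : Fin d, (2 * Real.pi) ^ 2))) ?_) measure_closedBall_lt_top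
  intro y hy
  rw [mem_closedBall_zero_iff, EuclideanSpace.norm_eq]
  apply Real.sqrt_le_sqrt
  apply Finset.sum_le_sum
  intro j _
  have h := hy j
  rw [Real.norm_eq_abs, sq_abs]
  exact pow_le_pow_left₀ h.1 h.2.le 2

theorem memLp_expMode {d : ℕ} (n : Fin d → ℤ) :
    MemLp (expMode n) 2 ((volume : Measure (E d)).restrict (cell d)) := by
  have : IsFiniteMeasure ((volume : Measure (E d)).restrict (cell d)) :=
    ⟨by simpa using volume_cell_lt_top d⟩
  have hc : Continuous (expMode n : E d → ℂ) := by
    unfold expMode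
    fun_prop
  refine MemLp.of_bound hc.aestronglyMeasurable 1 (Eventually.of_forall fun y => ?_)
  unfold expMode
  rw [mul_comm, Complex.norm_exp_ofReal_mul_I]

/-- The `n`-th Fourier coefficient `(2π)^{-d} ∫_Y u(y) e^{-i n · y} dy` of a periodic function. -/
def fourierCoeffPer {d : ℕ} (u : E d → ℂ) (n : Fin d → ℤ) : ℂ :=
  (((2 * Real.pi) ^ d : ℝ) : ℂ)⁻¹ * ∫ y in cell d, u y * conj (expMode n y)

/-- The `L²(Y)`-sum of the Fourier series `∑ₙ c(n) e^{i n · y}`. -/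
def fourierSeries {d : ℕ} (c : (Fin d → ℤ) → ℂ) :
    Lp ℂ 2 ((volume : Measure (E d)).restrict (cell d)) :=
  ∑' n, c n • (memLp_expMode n).toLp (expMode n)

/-- `u` belongs to the space of `Y`-periodic `H²` functions: it is periodic, square integrable on
`Y`, and `∑ₙ (1 + |n|²)² |û(n)|²` is finite. -/
structure MemH2Per {d : ℕ} (u : E d → ℂ) : Prop where
  periodic : ∀ p : Fin d → ℤ,
    ∀ᵐ y, u (y + WithLp.toLp 2 (fun j => 2 * Real.pi * (p j : ℝ))) = u y
  memLp : MemLp u 2 (volume.restrict (cell d))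
  summable : Summable fun n : Fin d → ℤ =>
    (1 + ∑ j, (n j : ℝ) ^ 2) ^ 2 * ‖fourierCoeffPer u n‖ ^ 2

/-- The `j`-th component of `(∇ + iη)u` on `Y`, for periodic `u`: the periodic function with
Fourier coefficients `i (n_j + η_j) û(n)`. -/
def shiftedPartial {d : ℕ} (η : E d) (j : Fin d) (u : E d → ℂ) :
    Lp ℂ 2 ((volume : Measure (E d)).restrict (cell d)) :=
  fourierSeries fun n => Complex.I * (((n j : ℝ) + η j : ℝ) : ℂ) * fourierCoeffPer u n

/-- `(∇ + iη)²u` on `Y`, for periodic `u`: the periodic function with Fourier coefficients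
`-|n + η|² û(n)`. -/
def shiftedLaplacian {d : ℕ} (η : E d) (u : E d → ℂ) :
    Lp ℂ 2 ((volume : Measure (E d)).restrict (cell d)) :=
  fourierSeries fun n => -((∑ j, ((n j : ℝ) + η j) ^ 2 : ℝ) : ℂ) * fourierCoeffPer u n

/-- The sesquilinear form
`∫_Y A (∇+iη)u · conj((∇+iη)v) dy + ρ² ∫_Y (∇+iη)²u conj((∇+iη)²v) dy`. -/
def shiftedForm {d : ℕ} (A : E d → Matrix (Fin d) (Fin d) ℝ) (ρ : ℝ) (η : E d)
    (u v : E d → ℂ) : ℂ :=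
  (∫ y in cell d, ∑ j, ∑ k,
      (A y j k : ℂ) * shiftedPartial η k u y * conj (shiftedPartial η j v y))
    + (ρ : ℂ) ^ 2 * ∫ y in cell d, shiftedLaplacian η u y * conj (shiftedLaplacian η v y)

/-! ### Bloch waves -/

/-- `(lam m η, φ m · η)`, `η ∈ Y'`, are the Bloch eigenvalues and eigenfunctions of
`ρ² Δ² - ∇ · A ∇`, numbered from `0` (so index `m` is the `(m+1)`-st mode): for each `η ∈ Y'` the
`lam m η` are the eigenvalues, in nondecreasing order and repeated with multiplicity, of
`ρ² (∇+iη)⁴ φ - (∇+iη) · A (∇+iη) φ = λ φ` (weakly, on periodic `H²` functions), and the `φ m · η`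
are corresponding eigenfunctions, chosen measurably, forming an orthonormal basis of `L²(Y)`. -/
structure IsBlochSystem {d : ℕ} (A : E d → Matrix (Fin d) (Fin d) ℝ) (ρ : ℝ)
    (lam : ℕ → E d → ℝ) (φ : ℕ → E d → E d → ℂ) : Prop where
  measurable : ∀ m, AEStronglyMeasurable (fun z : E d × E d => φ m z.1 z.2)
    (volume.prod (volume.restrict (dualCell d)))
  memH2 : ∀ η ∈ dualCell d, ∀ m, MemH2Per (fun y => φ m y η)
  eigen : ∀ η ∈ dualCell d, ∀ m, ∀ ψ : E d → ℂ, MemH2Per ψ →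
    shiftedForm A ρ η (fun y => φ m y η) ψ
      = (lam m η : ℂ) * ∫ y in cell d, φ m y η * conj (ψ y)
  mono : ∀ η ∈ dualCell d, Monotone fun m => lam m η
  orthonormal : ∀ η ∈ dualCell d, ∀ m n,
    ∫ y in cell d, φ m y η * conj (φ n y η) = if m = n then 1 else 0
  complete : ∀ η ∈ dualCell d, ∀ ψ : E d → ℂ, MemLp ψ 2 (volume.restrict (cell d)) →
    (∀ m, ∫ y in cell d, ψ y * conj (φ m y η) = 0) → ∀ᵐ y ∂(volume.restrict (cell d)), ψ y = 0

/-- The scaled dual cell `ε⁻¹ Y'`. -/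
def scaledDualCell (d : ℕ) (ε : ℝ) : Set (E d) := {ξ | ε • ξ ∈ dualCell d}

/-- The Bloch eigenfunction at scale `ε`, `x, ξ ↦ φ(x/ε; εξ)`. -/
def scaledMode {d : ℕ} (ε : ℝ) (φ : E d → E d → ℂ) (x ξ : E d) : ℂ := φ (ε⁻¹ • x) (ε • ξ)

/-- The plane wave `e^{i x · ξ}`. -/
def planeWave {d : ℕ} (x ξ : E d) : ℂ :=
  Complex.exp (Complex.I * ((∑ j, x j * ξ j : ℝ) : ℂ))

/-- `B` is the Bloch coefficient `ξ ↦ ∫ g(x) e^{-i x · ξ} conj(φ(x/ε; εξ)) dx` of `g ∈ L²(ℝ^d)`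
for the mode `φ`. As for the Fourier transform, the integral over `ℝ^d` is the limit in
`L²(ε⁻¹ Y')` of the integrals over balls. This determines `B` almost everywhere on `ε⁻¹ Y'`. -/
def IsBlochCoeff {d : ℕ} (ε : ℝ) (φ : E d → E d → ℂ) (g : L2 d) (B : E d → ℂ) : Prop :=
  MemLp B 2 (volume.restrict (scaledDualCell d ε)) ∧
  Tendsto (fun R : ℝ => eLpNorm
      (fun ξ => (∫ x in Metric.ball (0 : E d) R,
        g x * conj (planeWave x ξ) * conj (scaledMode ε φ x ξ)) - B ξ)
      2 (volume.restrict (scaledDualCell d ε)))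
    atTop (𝓝 0)

/-- `v(x) = ∫_{ε⁻¹ Y'} ∑_{m ≥ 1} B m ξ φ_m(x/ε; εξ) e^{i x · ξ} dξ`, the sum over all modes other
than the first one (which has index `0`), as the limit in `L²(ℝ^d)` of the partial sums. This
determines `v` as an element of `L²(ℝ^d)`. -/
def IsHigherModePart {d : ℕ} (ε : ℝ) (φ : ℕ → E d → E d → ℂ) (B : ℕ → E d → ℂ) (v : L2 d) :
    Prop :=
  Tendsto (fun N : ℕ => eLpNorm
      (fun x => (∫ ξ in scaledDualCell d ε,
        ∑ m ∈ Finset.Icc 1 N, B m ξ * scaledMode ε (φ m) x ξ * planeWave x ξ) - v x)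
      2 (volume : Measure (E d)))
    atTop (𝓝 0)

end

end BlochHom

namespace BlochHom

noncomputable section

/-! For `ξ` in `ε⁻¹ Y'`, the fibre of `u` is the periodic function with Fourier coefficients
`(2π)^{-d} û(ξ + n/ε)`, where `n` runs over `ℤ^d`. The translates of `ε⁻¹ Y'` by `n/ε` tile
frequency space, so Plancherel on `ℝ^d` and Parseval on the cell make `u ↦ fiber ε u` an isometry.
The Bloch coefficient of `u` at `ξ` is the inner product of its fibre with `φ_m(·; εξ)`.

The decay in `ε` comes from bounding the Hermitian form `Q` of the cell problem from both sides.
Lower bound: every eigenvalue but the first is at least `α/4`, uniformly in `ρ` and `η`. Indeed some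
nonzero combination of the first two eigenfunctions has mean zero, and its remaining frequencies
satisfy `|n + η| ≥ 1/2` (`IsBlochSystem.le_eigenvalue`). Upper bound: `Q(w, w) ≤ |β| d ‖(∇+iη)w‖² +
ρ² ‖(∇+iη)²w‖²`. When `w` is the fibre of `u` and `η = εξ`, the shifted gradient is `ε` times the
fibre of `∇u`, and the shifted Laplacian is `ε²` times the fibre of `Δu`. Since `ρ = κ/ε`, both
terms carry exactly `ε²`, and `κ` survives only in `κ‖Δu‖`
(`IsBlochSystem.sum_norm_blochCoeff_sq_le`).

Combined with `∑ λ_m |⟨φ_m, w⟩|² ≤ Q(w, w)` (`sum_eigenvalue_mul_norm_sq_le`) and integrated over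
`ξ`, these bound the higher coefficients in `L²` by a constant times `ε`. Synthesis is adjoint to
taking coefficients, so Bessel's inequality makes it a contraction
(`IsBlochSystem.lintegral_sum_synth_sq_le`). The series therefore converges and inherits the bound.
-/

/-! ### Fourier series on the periodicity cell -/

/-- Lebesgue measure on the periodicity cell. -/
abbrev cellMeasure (d : ℕ) : Measure (E d) := volume.restrict (cell d)

/-! ### Transfer of Fourier analysis from the unit torus to the cell. -/

section Torus

-- Normalised Haar measure serves as `volume` on the circle, so that the torus carries the product
-- probability measure for which the functions `mFourier n` are orthonormal.
local instance unitAddCircleMeasureSpace : MeasureSpace UnitAddCircle :=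
  ⟨AddCircle.haarAddCircle⟩

local instance : Measure.IsAddHaarMeasure (volume : Measure UnitAddCircle) :=
  inferInstanceAs (Measure.IsAddHaarMeasure AddCircle.haarAddCircle)

local instance : IsProbabilityMeasure (volume : Measure UnitAddCircle) :=
  inferInstanceAs (IsProbabilityMeasure AddCircle.haarAddCircle)

/-- The measurable section of the covering map `y ↦ y / 2π` from the cell to the torus. -/
def torusSection (d : ℕ) (t : UnitAddTorus (Fin d)) : E d :=
  (2 * Real.pi) • WithLp.toLp 2 (fun i => (AddCircle.equivIoc 1 0 (t i)).1)

/-- `AddCircle.equivIoc` takes values in intervals closed on the right, whereas the cell is closed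
on the left. The difference lies in null faces. -/
theorem cell_ae_eq_Ioc (d : ℕ) :
    {y : E d | ∀ j, y j ∈ Set.Ioc 0 (2 * Real.pi)} =ᵐ[volume] cell d := by
  have h1 : (Set.univ.pi fun _ : Fin d => Set.Ioc (0 : ℝ) (2 * Real.pi)) =ᵐ[volume]
      (Set.univ.pi fun _ : Fin d => Set.Ico (0 : ℝ) (2 * Real.pi)) :=
    (Measure.univ_pi_Ioc_ae_eq_Icc (μ := fun _ : Fin d => (volume : Measure ℝ))).trans
      (Measure.univ_pi_Ico_ae_eq_Icc (μ := fun _ : Fin d => (volume : Measure ℝ))).symm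
  have h2 := (PiLp.volume_preserving_ofLp (Fin d)).quasiMeasurePreserving.preimage_ae_eq h1
  have e1 : {y : E d | ∀ j, y j ∈ Set.Ioc 0 (2 * Real.pi)} =
      WithLp.ofLp ⁻¹' (Set.univ.pi fun _ : Fin d => Set.Ioc (0 : ℝ) (2 * Real.pi)) := by
    ext y; simp
  have e2 : cell d =
      WithLp.ofLp ⁻¹' (Set.univ.pi fun _ : Fin d => Set.Ico (0 : ℝ) (2 * Real.pi)) := by
    ext y; simp [cell]
  rw [e1, e2]
  exact h2

/-- The section factors as the identification of the torus with the unit box followed by dilation by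
`2π`. Each identification preserves the measure, and the dilation contributes the factor
`(2π)^{-d}`. -/
theorem measurePreserving_torusSection (d : ℕ) :
    MeasurePreserving (torusSection d) volume
      (ENNReal.ofReal (((2 * Real.pi) ^ d)⁻¹) • cellMeasure d) := by
  set S : Set (Fin d → ℝ) := {x | ∀ i, x i ∈ Set.Ioc ((0 : Fin d → ℝ) i) ((0 : Fin d → ℝ) i + 1)}
    with hS
  have mS : MeasurableSet S := MeasurableSet.univ_pi' (fun i => measurableSet_Ioc)
  set S' : Set (E d) := {y | ∀ i, y i ∈ Set.Ioc (0 : ℝ) 1} with hS'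
  have mS' : MeasurableSet S' := by
    have : S' = ⋂ i, (fun y : E d => y i) ⁻¹' Set.Ioc (0 : ℝ) 1 := by ext; simp [hS']
    rw [this]
    exact MeasurableSet.iInter fun i => (by fun_prop : Measurable fun y : E d => y i)
      measurableSet_Ioc
  have A := UnitAddTorus.measurePreserving_equivPiIoc (0 : Fin d → ℝ)
  have B : MeasurePreserving (Subtype.val : S → (Fin d → ℝ)) (Measure.comap Subtype.val volume)
    (volume.restrict S) := measurePreserving_subtype_coe mS
  have C : MeasurePreserving (WithLp.toLp 2 : (Fin d → ℝ) → E d) (volume.restrict S)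
      (volume.restrict S') := by
    convert! (PiLp.volume_preserving_toLp (Fin d)).restrict_preimage mS' using 2
    ext x; simp [hS, hS']
  have hpi : (2 * Real.pi) ≠ 0 := by positivity
  have Dm : MeasurePreserving (fun y : E d => (2 * Real.pi) • y) volume
      (ENNReal.ofReal (((2 * Real.pi) ^ d)⁻¹) • volume) := by
    refine ⟨by fun_prop, ?_⟩
    rw [Measure.map_addHaar_smul _ hpi]
    congr 2
    simp [abs_of_pos (Real.pi_pos)]
  have mC : MeasurableSet {y : E d | ∀ j, y j ∈ Set.Ioc 0 (2 * Real.pi)} := by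
    have : {y : E d | ∀ j, y j ∈ Set.Ioc 0 (2 * Real.pi)} =
        ⋂ i, (fun y : E d => y i) ⁻¹' Set.Ioc (0 : ℝ) (2 * Real.pi) := by ext; simp
    rw [this]
    exact MeasurableSet.iInter fun i => (by fun_prop : Measurable fun y : E d => y i)
      measurableSet_Ioc
  have D' := Dm.restrict_preimage mC
  have e1 : (fun y : E d => (2 * Real.pi) • y) ⁻¹' {y : E d | ∀ j, y j ∈ Set.Ioc 0 (2 * Real.pi)}
      = S' := by
    ext y
    simp only [Set.mem_preimage, Set.mem_ofPred_eq, hS', Set.mem_Ioc, PiLp.smul_apply, smul_eq_mul]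
    refine forall_congr' fun j => ?_
    have := Real.two_pi_pos
    constructor
    · rintro ⟨h1, h2⟩
      exact ⟨by by_contra h; nlinarith, by by_contra h; nlinarith⟩
    · rintro ⟨h1, h2⟩
      exact ⟨by positivity, by nlinarith⟩
  rw [e1, Measure.restrict_smul, Measure.restrict_congr_set (cell_ae_eq_Ioc d)] at D'
  exact D'.comp (C.comp (B.comp A))

theorem expMode_torusSection {d : ℕ} (n : Fin d → ℤ) (t : UnitAddTorus (Fin d)) :
    expMode n (torusSection d t) = UnitAddTorus.mFourier n t := by
  have h : ∀ i, ((AddCircle.equivIoc (1 : ℝ) 0 (t i)).1 : UnitAddCircle) = t i := fun i =>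
    (AddCircle.equivIoc (1 : ℝ) 0).symm_apply_apply (t i)
  have h2 : UnitAddTorus.mFourier n t =
      ∏ i, fourier (n i) (((AddCircle.equivIoc (1 : ℝ) 0 (t i)).1 : ℝ) : UnitAddCircle) := by
    simp only [h]; rfl
  rw [h2]
  simp only [fourier_coe_apply, ← Complex.exp_sum, expMode, torusSection, PiLp.smul_apply]
  congr 1
  push_cast
  rw [Finset.mul_sum]
  refine Finset.sum_congr rfl fun i _ => ?_
  simp
  ring

theorem integral_torusSection {d : ℕ} {f : E d → ℂ} (hf : AEStronglyMeasurable f (cellMeasure d)) :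
    ∫ t, f (torusSection d t) = (((2 * Real.pi) ^ d : ℝ) : ℂ)⁻¹ * ∫ y in cell d, f y := by
  have hp := measurePreserving_torusSection d
  rw [← integral_map hp.measurable.aemeasurable (by rw [hp.map_eq]; exact hf.smul_measure _),
    hp.map_eq, integral_smul_measure, ENNReal.toReal_ofReal (by positivity), Complex.real_smul]
  push_cast
  rfl

theorem continuous_expMode {d : ℕ} (n : Fin d → ℤ) : Continuous (expMode n : E d → ℂ) := by
  unfold expMode
  fun_prop

theorem integral_expMode_mul_conj {d : ℕ} (m n : Fin d → ℤ) :
    ∫ y in cell d, expMode n y * conj (expMode m y) =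
      if m = n then (((2 * Real.pi) ^ d : ℝ) : ℂ) else 0 := by
  have h := integral_torusSection (d := d) (f := fun y => expMode n y * conj (expMode m y))
    (by
      have := continuous_expMode n
      have := continuous_expMode m
      exact Continuous.aestronglyMeasurable (by fun_prop))
  have h2 := (orthonormal_iff_ite.mp (UnitAddTorus.orthonormal_mFourier (d := Fin d))) m n
  simp only [ContinuousMap.inner_toLp] at h2
  simp only [expMode_torusSection] at h
  have h3 : (((2 * Real.pi) ^ d : ℝ) : ℂ) ≠ 0 := by
    have : ((2 * Real.pi) ^ d : ℝ) ≠ 0 := by positivity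
    exact_mod_cast this
  have h4 : ∫ t : UnitAddTorus (Fin d),
      UnitAddTorus.mFourier n t * conj (UnitAddTorus.mFourier m t) = if m = n then 1 else 0 := by
    rw [← h2]
  rw [h4] at h
  rw [eq_comm, inv_mul_eq_iff_eq_mul₀ h3] at h
  rw [h]
  split_ifs <;> simp

/-- Completeness of the exponentials on the cell. Pulled back to the torus, `u` has vanishing
Fourier coefficients and hence vanishes. The `L²` norm changes only by a nonzero finite factor under
the pullback. -/
theorem ae_eq_zero_of_integral_conj_expMode {d : ℕ} {u : E d → ℂ}
    (hu : MemLp u 2 (cellMeasure d))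
    (h : ∀ n, ∫ y in cell d, u y * conj (expMode n y) = 0) : u =ᵐ[cellMeasure d] 0 := by
  have hp := measurePreserving_torusSection d
  have hu' : MemLp u 2 (ENNReal.ofReal (((2 * Real.pi) ^ d)⁻¹) • cellMeasure d) :=
    hu.smul_measure ENNReal.ofReal_ne_top
  have hw : MemLp (u ∘ torusSection d) 2 volume := hu'.comp_measurePreserving hp
  have hc : ∀ n, UnitAddTorus.mFourierCoeff (hw.toLp _) n = 0 := by
    intro n
    have : UnitAddTorus.mFourierCoeff (hw.toLp _) n =
        ∫ t, (fun y => u y * conj (expMode n y)) (torusSection d t) := by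
      refine integral_congr_ae ?_
      filter_upwards [hw.coeFn_toLp] with t ht
      rw [ht, UnitAddTorus.mFourier_neg, ← expMode_torusSection, smul_eq_mul, mul_comm]
      rfl
    have hm : AEStronglyMeasurable (fun y => u y * conj (expMode n y)) (cellMeasure d) :=
      hu.1.mul (Complex.continuous_conj.comp (continuous_expMode n)).aestronglyMeasurable
    rw [this, integral_torusSection hm, h n, mul_zero]
  have hz : hw.toLp _ = 0 := by
    have := UnitAddTorus.hasSum_mFourier_series_L2 (hw.toLp _)
    simp only [hc, zero_smul] at this
    exact this.unique hasSum_zero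
  have h0 : eLpNorm (u ∘ torusSection d) 2 volume = 0 := by
    have := hw.coeFn_toLp
    rw [hz] at this
    rw [← eLpNorm_congr_ae this, eLpNorm_congr_ae (Lp.coeFn_zero _ _ _)]
    exact eLpNorm_zero
  rw [eLpNorm_comp_measurePreserving hu'.1 hp, eLpNorm_smul_measure_of_ne_zero] at h0
  · rw [smul_eq_mul, mul_eq_zero] at h0
    rcases h0 with h0 | h0
    · exfalso
      rw [ENNReal.rpow_eq_zero_iff] at h0
      have h3 : (0:ℝ) < ((2 * Real.pi) ^ d)⁻¹ := by positivity
      rcases h0 with h0 | h0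
      · exact absurd h0.1 (by simpa using h3)
      · exact absurd h0.1 ENNReal.ofReal_ne_top
    · exact (eLpNorm_eq_zero_iff hu.1 (by norm_num)).mp h0
  · have h3 : (0:ℝ) < ((2 * Real.pi) ^ d)⁻¹ := by positivity
    simpa using h3

end Torus

/-! ### The Hilbert basis of exponentials and Parseval's identity. -/

/-- The volume of the cell. -/
def cellVol (d : ℕ) : ℝ := (2 * Real.pi) ^ d

theorem cellVol_pos (d : ℕ) : 0 < cellVol d := by unfold cellVol; positivity

/-- The exponential as an element of `L²` of the cell. -/
def expLp {d : ℕ} (n : Fin d → ℤ) : Lp ℂ 2 (cellMeasure d) := (memLp_expMode n).toLp (expMode n)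

theorem coeFn_expLp {d : ℕ} (n : Fin d → ℤ) : expLp n =ᵐ[cellMeasure d] expMode n :=
  (memLp_expMode n).coeFn_toLp

theorem inner_toLp {d : ℕ} {u v : E d → ℂ} (hu : MemLp u 2 (cellMeasure d))
    (hv : MemLp v 2 (cellMeasure d)) :
    inner ℂ (hu.toLp u) (hv.toLp v) = ∫ y in cell d, v y * conj (u y) := by
  rw [L2.inner_def]
  refine integral_congr_ae ?_
  filter_upwards [hu.coeFn_toLp, hv.coeFn_toLp] with y h1 h2
  rw [h1, h2, RCLike.inner_apply]

theorem inner_Lp {d : ℕ} (u v : Lp ℂ 2 (cellMeasure d)) :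
    inner ℂ u v = ∫ y in cell d, v y * conj (u y) := by
  rw [L2.inner_def]
  rfl

theorem inner_expLp {d : ℕ} (m n : Fin d → ℤ) :
    inner ℂ (expLp m) (expLp n) = if m = n then (cellVol d : ℂ) else 0 := by
  rw [expLp, expLp, inner_toLp, integral_expMode_mul_conj]
  rfl

theorem inner_expLp_toLp {d : ℕ} (n : Fin d → ℤ) {u : E d → ℂ} (hu : MemLp u 2 (cellMeasure d)) :
    inner ℂ (expLp n) (hu.toLp u) = cellVol d * fourierCoeffPer u n := by
  have h3 : (cellVol d : ℂ) ≠ 0 := by exact_mod_cast (cellVol_pos d).ne'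
  rw [expLp, inner_toLp, fourierCoeffPer]
  change _ = (cellVol d : ℂ) * ((cellVol d : ℂ)⁻¹ * _)
  rw [mul_inv_cancel_left₀ h3]

theorem orthonormal_expLp (d : ℕ) :
    Orthonormal ℂ fun n : Fin d → ℤ => ((Real.sqrt (cellVol d))⁻¹ : ℂ) • expLp n := by
  rw [orthonormal_iff_ite]
  intro m n
  rw [inner_smul_left, inner_smul_right, inner_expLp]
  split_ifs
  · have h : (Real.sqrt (cellVol d) : ℂ) * Real.sqrt (cellVol d) = cellVol d := by
      rw [← Complex.ofReal_mul, Real.mul_self_sqrt (cellVol_pos d).le]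
    have h0 : (Real.sqrt (cellVol d) : ℂ) ≠ 0 := by
      exact_mod_cast (Real.sqrt_pos.mpr (cellVol_pos d)).ne'
    rw [← h, map_inv₀, Complex.conj_ofReal]
    field_simp
  · simp

/-- The normalised exponentials form a Hilbert basis of `L²` of the cell. -/
def cellBasis (d : ℕ) : HilbertBasis (Fin d → ℤ) ℂ (Lp ℂ 2 (cellMeasure d)) :=
  HilbertBasis.mkOfOrthogonalEqBot (orthonormal_expLp d) (by
    rw [Submodule.eq_bot_iff]
    intro w hw
    have h : ∀ n, ∫ y in cell d, w y * conj (expMode n y) = 0 := by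
      intro n
      have h1 := hw _ (Submodule.subset_span (Set.mem_range_self n))
      rw [inner_smul_left, mul_eq_zero] at h1
      rcases h1 with h1 | h1
      · exfalso
        rw [map_inv₀, Complex.conj_ofReal, inv_eq_zero] at h1
        exact (Real.sqrt_pos.mpr (cellVol_pos d)).ne' (by exact_mod_cast h1)
      · rw [inner_Lp] at h1
        rw [← h1]
        refine integral_congr_ae ?_
        filter_upwards [coeFn_expLp n] with y hy
        rw [hy]
    have := ae_eq_zero_of_integral_conj_expMode (Lp.memLp w) h
    exact (Lp.eq_zero_iff_ae_eq_zero).mpr this)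

theorem cellBasis_apply {d : ℕ} (n : Fin d → ℤ) :
    cellBasis d n = ((Real.sqrt (cellVol d))⁻¹ : ℂ) • expLp n := by
  unfold cellBasis
  rw [HilbertBasis.coe_mkOfOrthogonalEqBot]

theorem sqrt_cellVol_ne_zero (d : ℕ) : (Real.sqrt (cellVol d) : ℂ) ≠ 0 := by
  exact_mod_cast (Real.sqrt_pos.mpr (cellVol_pos d)).ne'

theorem sqrt_cellVol_mul_self (d : ℕ) :
    (Real.sqrt (cellVol d) : ℂ) * Real.sqrt (cellVol d) = cellVol d := by
  rw [← Complex.ofReal_mul, Real.mul_self_sqrt (cellVol_pos d).le]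

theorem cellVol_ne_zero (d : ℕ) : (cellVol d : ℂ) ≠ 0 := by
  exact_mod_cast (cellVol_pos d).ne'

theorem inner_cellBasis_toLp {d : ℕ} (n : Fin d → ℤ) {u : E d → ℂ}
    (hu : MemLp u 2 (cellMeasure d)) :
    inner ℂ (cellBasis d n) (hu.toLp u) = Real.sqrt (cellVol d) * fourierCoeffPer u n := by
  rw [cellBasis_apply, inner_smul_left, inner_expLp_toLp, map_inv₀, Complex.conj_ofReal,
    ← sqrt_cellVol_mul_self]
  field_simp [sqrt_cellVol_ne_zero d]

/-- Parseval's identity on the cell. -/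
theorem hasSum_fourierCoeffPer_mul_conj {d : ℕ} {u v : E d → ℂ} (hu : MemLp u 2 (cellMeasure d))
    (hv : MemLp v 2 (cellMeasure d)) :
    HasSum (fun n => (cellVol d : ℂ) * (fourierCoeffPer u n * conj (fourierCoeffPer v n)))
      (∫ y in cell d, u y * conj (v y)) := by
  rw [← inner_toLp hv hu]
  refine ((cellBasis d).hasSum_inner_mul_inner _ _).congr_fun fun n => ?_
  rw [← inner_conj_symm, inner_cellBasis_toLp, inner_cellBasis_toLp, ← sqrt_cellVol_mul_self,
    map_mul, Complex.conj_ofReal]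
  ring

theorem hasSum_norm_fourierCoeffPer_sq {d : ℕ} {u : E d → ℂ} (hu : MemLp u 2 (cellMeasure d)) :
    HasSum (fun n => cellVol d * ‖fourierCoeffPer u n‖ ^ 2) (‖hu.toLp u‖ ^ 2) := by
  have h := hasSum_fourierCoeffPer_mul_conj hu hu
  rw [← inner_toLp hu hu, inner_self_eq_norm_sq_to_K] at h
  have h2 := Complex.hasSum_re h
  convert! h2 using 1
  · ext n
    rw [Complex.mul_conj, Complex.normSq_eq_norm_sq]
    norm_cast
  · norm_cast

/-- The Fourier series of a function in `L²` of the cell converges to the function. -/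
theorem hasSum_fourierCoeffPer {d : ℕ} {u : E d → ℂ} (hu : MemLp u 2 (cellMeasure d)) :
    HasSum (fun n => fourierCoeffPer u n • expLp n) (hu.toLp u) := by
  refine ((cellBasis d).hasSum_repr (hu.toLp u)).congr_fun fun n => ?_
  rw [HilbertBasis.repr_apply_apply, inner_cellBasis_toLp, cellBasis_apply, smul_smul]
  congr 1
  field_simp [sqrt_cellVol_ne_zero d]

/-- `fourierSeries` is a `tsum`, which takes a default value when the family is not summable. Square
summability makes the family an expansion in `cellBasis`, with coefficients `√(cellVol d) * c n`, so
the sum is genuine. -/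
theorem hasSum_fourierSeries {d : ℕ} {c : (Fin d → ℤ) → ℂ} (hc : Summable fun n => ‖c n‖ ^ 2) :
    HasSum (fun n => c n • expLp n) (fourierSeries c) := by
  have hm : Memℓp (fun n => (Real.sqrt (cellVol d) : ℂ) * c n) 2 := by
    rw [memℓp_gen_iff (by norm_num)]
    simpa [mul_pow] using hc.mul_left _
  have h := (cellBasis d).hasSum_repr_symm (⟨_, hm⟩ : lp (fun _ : Fin d → ℤ => ℂ) 2)
  have h2 : HasSum (fun n => c n • expLp n)
      ((cellBasis d).repr.symm (⟨_, hm⟩ : lp (fun _ : Fin d → ℤ => ℂ) 2)) := by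
    refine h.congr_fun fun n => ?_
    change _ = ((Real.sqrt (cellVol d) : ℂ) * c n) • cellBasis d n
    rw [cellBasis_apply, smul_smul]
    congr 1
    field_simp [sqrt_cellVol_ne_zero d]
  exact h2.summable.hasSum

theorem fourierCoeffPer_congr {d : ℕ} {u v : E d → ℂ} (h : u =ᵐ[cellMeasure d] v)
    (n : Fin d → ℤ) : fourierCoeffPer u n = fourierCoeffPer v n := by
  unfold fourierCoeffPer
  congr 1
  exact integral_congr_ae (by filter_upwards [h] with y hy; rw [hy])

theorem inner_expLp_Lp {d : ℕ} (n : Fin d → ℤ) (u : Lp ℂ 2 (cellMeasure d)) :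
    inner ℂ (expLp n) u = cellVol d * fourierCoeffPer u n := by
  conv_lhs => rw [← Lp.toLp_coeFn u (Lp.memLp u)]
  exact inner_expLp_toLp n (Lp.memLp u)

theorem fourierCoeffPer_fourierSeries {d : ℕ} {c : (Fin d → ℤ) → ℂ}
    (hc : Summable fun n => ‖c n‖ ^ 2) (n : Fin d → ℤ) :
    fourierCoeffPer (fourierSeries c) n = c n := by
  have h := (hasSum_fourierSeries hc).mapL (innerSL ℂ (expLp n))
  simp only [innerSL_apply_apply, inner_smul_right, inner_expLp] at h
  rw [inner_expLp_Lp] at h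
  have h2 := h.unique (hasSum_single n (fun m hm => by rw [if_neg (Ne.symm hm), mul_zero]))
  rw [if_pos rfl, mul_comm] at h2
  exact mul_right_cancel₀ (cellVol_ne_zero d) h2

theorem norm_fourierSeries_sq {d : ℕ} {c : (Fin d → ℤ) → ℂ}
    (hc : Summable fun n => ‖c n‖ ^ 2) :
    HasSum (fun n => cellVol d * ‖c n‖ ^ 2) (‖fourierSeries c‖ ^ 2) := by
  have h := hasSum_norm_fourierCoeffPer_sq (Lp.memLp (fourierSeries c))
  simp only [fourierCoeffPer_fourierSeries hc] at h
  rwa [Lp.toLp_coeFn] at h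

theorem fourierSeries_add {d : ℕ} {b c : (Fin d → ℤ) → ℂ} (hb : Summable fun n => ‖b n‖ ^ 2)
    (hc : Summable fun n => ‖c n‖ ^ 2) :
    fourierSeries (fun n => b n + c n) = fourierSeries b + fourierSeries c := by
  have h := (hasSum_fourierSeries hb).add (hasSum_fourierSeries hc)
  simp only [← add_smul] at h
  exact h.tsum_eq

theorem fourierSeries_smul {d : ℕ} (a : ℂ) {c : (Fin d → ℤ) → ℂ}
    (hc : Summable fun n => ‖c n‖ ^ 2) :
    fourierSeries (fun n => a * c n) = a • fourierSeries c := by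
  have h := (hasSum_fourierSeries hc).const_smul a
  simp only [smul_smul] at h
  exact h.tsum_eq

/-! ### Hermitian forms and eigenvectors -/

/-- If `φ i`, `i ∈ s`, are orthonormal eigenvectors of a nonnegative Hermitian form `Q`, then
`∑ λ i |⟨φ i, w⟩|² ≤ Q(w, w)`. -/
theorem sum_eigenvalue_mul_norm_sq_le {V H ι : Type*} [AddCommGroup V] [Module ℂ V]
    [NormedAddCommGroup H] [InnerProductSpace ℂ H] (T : V →ₗ[ℂ] H)
    (Q : V →ₗ⋆[ℂ] V →ₗ[ℂ] ℂ) (hQ : ∀ u v, Q u v = conj (Q v u)) (hpos : ∀ u, 0 ≤ (Q u u).re)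
    (φ : ι → V) (hφ : Orthonormal ℂ (T ∘ φ)) (lam : ι → ℝ)
    (heig : ∀ i ψ, Q ψ (φ i) = lam i * inner ℂ (T ψ) (T (φ i))) (s : Finset ι) (w : V) :
    ∑ i ∈ s, lam i * ‖inner ℂ (T (φ i)) (T w)‖ ^ 2 ≤ (Q w w).re := by
  classical
  set b : ι → ℂ := fun i => inner ℂ (T (φ i)) (T w) with hb
  -- `v` is `w` minus its projection on the chosen eigenvectors. Then `Q(v, φ i) = λ i ⟨v, φ i⟩ =
  -- 0`, so `Q(v, v) = Q(v, w) = Q(w, w) - ∑ λ i |b i|²`, and positivity of `Q` at `v` is the claim.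
  set v := w - ∑ i ∈ s, b i • φ i with hv
  have h1 : ∀ i ∈ s, inner ℂ (T v) (T (φ i)) = 0 := by
    intro i hi
    rw [← inner_conj_symm, hv, map_sub, map_sum, inner_sub_right, inner_sum]
    simp only [map_smul, inner_smul_right]
    have h2 : ∀ j, inner ℂ (T (φ i)) (T (φ j)) = if i = j then (1 : ℂ) else 0 :=
      fun j => (orthonormal_iff_ite.mp hφ) i j
    simp [h2, hi, hb]
  have h2 : Q v v = Q v w := by
    conv_lhs => rw [hv]
    rw [map_sub, map_sum, ← hv]
    rw [Finset.sum_eq_zero, sub_zero]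
    intro i hi
    rw [map_smul, heig, h1 i hi]
    simp
  have h3 : Q v w = Q w w - ∑ i ∈ s, conj (b i) * (lam i * b i) := by
    conv_lhs => rw [hv]
    rw [map_sub, map_sum]
    simp only [LinearMap.sub_apply, LinearMap.sum_apply]
    congr 1
    refine Finset.sum_congr rfl fun i _ => ?_
    rw [LinearMap.map_smulₛₗ, LinearMap.smul_apply, smul_eq_mul, hQ, heig, map_mul,
      Complex.conj_ofReal, inner_conj_symm (T (φ i))]
  have h4 := hpos v
  rw [h2, h3, Complex.sub_re, Complex.re_sum] at h4
  have h5 : ∀ i, (conj (b i) * (lam i * b i)).re = lam i * ‖b i‖ ^ 2 := by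
    intro i
    rw [mul_left_comm, mul_comm (conj (b i)), Complex.mul_conj, Complex.normSq_eq_norm_sq]
    norm_cast
  simp only [h5] at h4
  linarith

/-! ### The space of periodic `H²` functions -/

theorem integrable_mul_conj_expMode {d : ℕ} {u : E d → ℂ} (hu : MemLp u 2 (cellMeasure d))
    (n : Fin d → ℤ) : Integrable (fun y => u y * conj (expMode n y)) (cellMeasure d) := by
  have h := (memLp_expMode n).star
  exact hu.integrable_mul h

theorem fourierCoeffPer_add {d : ℕ} {u v : E d → ℂ} (hu : MemLp u 2 (cellMeasure d))
    (hv : MemLp v 2 (cellMeasure d)) (n : Fin d → ℤ) :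
    fourierCoeffPer (u + v) n = fourierCoeffPer u n + fourierCoeffPer v n := by
  unfold fourierCoeffPer
  rw [← mul_add, ← integral_add (integrable_mul_conj_expMode hu n)
    (integrable_mul_conj_expMode hv n)]
  simp only [Pi.add_apply, add_mul]

theorem fourierCoeffPer_smul {d : ℕ} (a : ℂ) (u : E d → ℂ) (n : Fin d → ℤ) :
    fourierCoeffPer (a • u) n = a * fourierCoeffPer u n := by
  unfold fourierCoeffPer
  simp only [Pi.smul_apply, smul_eq_mul, mul_assoc]
  rw [integral_const_mul]
  ring

/-- The periodic `H²` functions. -/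
def h2Per (d : ℕ) : Submodule ℂ (E d → ℂ) where
  carrier := {u | MemH2Per u}
  zero_mem' :=
    { periodic := fun p => by simp
      memLp := MemLp.zero
      summable := by
        have : ∀ n : Fin d → ℤ, fourierCoeffPer (0 : E d → ℂ) n = 0 := by
          intro n; simp [fourierCoeffPer]
        simp [this, summable_zero] }
  add_mem' := by
    intro u v hu hv
    refine ⟨fun p => ?_, hu.memLp.add hv.memLp, ?_⟩
    · filter_upwards [hu.periodic p, hv.periodic p] with y h1 h2
      simp only [Pi.add_apply, h1, h2]
    · refine Summable.of_nonneg_of_le (fun n => by positivity) (fun n => ?_)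
        ((hu.summable.add hv.summable).mul_left 2)
      rw [fourierCoeffPer_add hu.memLp hv.memLp, ← mul_add, mul_left_comm]
      refine mul_le_mul_of_nonneg_left ?_ (by positivity)
      have h1 := norm_add_le (fourierCoeffPer u n) (fourierCoeffPer v n)
      nlinarith [norm_nonneg (fourierCoeffPer u n + fourierCoeffPer v n),
        sq_nonneg (‖fourierCoeffPer u n‖ - ‖fourierCoeffPer v n‖),
        pow_le_pow_left₀ (norm_nonneg _) h1 2]
  smul_mem' := by
    intro a u hu
    refine ⟨fun p => ?_, hu.memLp.const_smul a, ?_⟩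
    · filter_upwards [hu.periodic p] with y h1
      simp only [Pi.smul_apply, h1]
    · refine (hu.summable.mul_left (‖a‖ ^ 2)).congr fun n => ?_
      rw [fourierCoeffPer_smul, norm_mul]
      ring

/-- Bounds the symbols of the shifted derivatives by the `H²` weight `1 + |n|²`, so that the series
defining these derivatives converge. -/
theorem sum_add_sq_le {d : ℕ} (η : E d) (n : Fin d → ℤ) :
    ∑ j, ((n j : ℝ) + η j) ^ 2 ≤ 2 * (1 + ∑ j, η j ^ 2) * (1 + ∑ j, (n j : ℝ) ^ 2) := by
  have h : ∑ j, ((n j : ℝ) + η j) ^ 2 ≤ 2 * ∑ j, (n j : ℝ) ^ 2 + 2 * ∑ j, η j ^ 2 := by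
    rw [Finset.mul_sum, Finset.mul_sum, ← Finset.sum_add_distrib]
    exact Finset.sum_le_sum fun j _ => by nlinarith [sq_nonneg ((n j : ℝ) - η j)]
  have h1 : 0 ≤ ∑ j, (n j : ℝ) ^ 2 := by positivity
  have h2 : 0 ≤ ∑ j, η j ^ 2 := by positivity
  nlinarith [mul_nonneg h1 h2]

theorem MemH2Per.summable_shiftedLaplacian {d : ℕ} {u : E d → ℂ} (hu : MemH2Per u) (η : E d) :
    Summable fun n : Fin d → ℤ =>
      ‖-((∑ j, ((n j : ℝ) + η j) ^ 2 : ℝ) : ℂ) * fourierCoeffPer u n‖ ^ 2 := by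
  refine Summable.of_nonneg_of_le (fun n => by positivity) (fun n => ?_)
    (hu.summable.mul_left ((2 * (1 + ∑ j, η j ^ 2)) ^ 2))
  have h0 : 0 ≤ ∑ j, ((n j : ℝ) + η j) ^ 2 := by positivity
  rw [norm_mul, norm_neg, Complex.norm_real, Real.norm_eq_abs, abs_of_nonneg h0,
    mul_pow, ← mul_assoc]
  refine mul_le_mul_of_nonneg_right ?_ (by positivity)
  rw [← mul_pow]
  exact pow_le_pow_left₀ h0 (sum_add_sq_le η n) 2

theorem MemH2Per.summable_shiftedPartial {d : ℕ} {u : E d → ℂ} (hu : MemH2Per u) (η : E d)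
    (j : Fin d) :
    Summable fun n : Fin d → ℤ =>
      ‖Complex.I * (((n j : ℝ) + η j : ℝ) : ℂ) * fourierCoeffPer u n‖ ^ 2 := by
  refine Summable.of_nonneg_of_le (fun n => by positivity) (fun n => ?_)
    (hu.summable.mul_left (2 * (1 + ∑ j, η j ^ 2)))
  rw [norm_mul, norm_mul, Complex.norm_I, one_mul, Complex.norm_real, Real.norm_eq_abs, mul_pow,
    sq_abs, ← mul_assoc]
  refine mul_le_mul_of_nonneg_right ?_ (by positivity)
  have h1 : ((n j : ℝ) + η j) ^ 2 ≤ ∑ j, ((n j : ℝ) + η j) ^ 2 :=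
    Finset.single_le_sum (f := fun j => ((n j : ℝ) + η j) ^ 2) (fun i _ => sq_nonneg _)
      (Finset.mem_univ j)
  refine (h1.trans (sum_add_sq_le η n)).trans (mul_le_mul_of_nonneg_left ?_ (by positivity))
  exact le_self_pow₀ (by have : 0 ≤ ∑ j, (n j : ℝ) ^ 2 := by positivity
                         linarith) two_ne_zero

/-- The class of a periodic `H²` function in `L²` of the cell. -/
def h2PerToLp (d : ℕ) : h2Per d →ₗ[ℂ] Lp ℂ 2 (cellMeasure d) where
  toFun u := u.2.memLp.toLp u.1
  map_add' u v := MemLp.toLp_add u.2.memLp v.2.memLp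
  map_smul' a u := MemLp.toLp_const_smul a u.2.memLp

/-- The shifted partial derivative as a linear map. -/
def shiftedPartialₗ {d : ℕ} (η : E d) (j : Fin d) : h2Per d →ₗ[ℂ] Lp ℂ 2 (cellMeasure d) where
  toFun u := shiftedPartial η j u.1
  map_add' u v := by
    unfold shiftedPartial
    rw [← fourierSeries_add (u.2.summable_shiftedPartial η j) (v.2.summable_shiftedPartial η j)]
    congr 1
    ext n
    rw [Submodule.coe_add, fourierCoeffPer_add u.2.memLp v.2.memLp, mul_add]
  map_smul' a u := by
    unfold shiftedPartial
    rw [RingHom.id_apply, ← fourierSeries_smul a (u.2.summable_shiftedPartial η j)]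
    congr 1
    ext n
    rw [Submodule.coe_smul, fourierCoeffPer_smul, mul_left_comm]

/-- The shifted Laplacian as a linear map. -/
def shiftedLaplacianₗ {d : ℕ} (η : E d) : h2Per d →ₗ[ℂ] Lp ℂ 2 (cellMeasure d) where
  toFun u := shiftedLaplacian η u.1
  map_add' u v := by
    unfold shiftedLaplacian
    rw [← fourierSeries_add (u.2.summable_shiftedLaplacian η) (v.2.summable_shiftedLaplacian η)]
    congr 1
    ext n
    rw [Submodule.coe_add, fourierCoeffPer_add u.2.memLp v.2.memLp, mul_add]
  map_smul' a u := by
    unfold shiftedLaplacian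
    rw [RingHom.id_apply, ← fourierSeries_smul a (u.2.summable_shiftedLaplacian η)]
    congr 1
    ext n
    rw [Submodule.coe_smul, fourierCoeffPer_smul, mul_left_comm]

/-! ### The form of the operator -/

section Form

variable {d : ℕ} {α β : ℝ} {A : E d → Matrix (Fin d) (Fin d) ℝ}

theorem IsAdmissible.integrable_entry (hA : IsAdmissible α β A) (j k : Fin d)
    (f g : Lp ℂ 2 (cellMeasure d)) :
    Integrable (fun y => (A y j k : ℂ) * f y * conj (g y)) (cellMeasure d) := by
  have h : Integrable (fun y => f y * conj (g y)) (cellMeasure d) :=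
    (Lp.memLp f).integrable_mul (Lp.memLp g).star
  simp only [mul_assoc]
  refine h.bdd_mul (c := β)
    (Complex.continuous_ofReal.comp_aestronglyMeasurable
      (hA.measurable j k).restrict.aestronglyMeasurable) ?_
  filter_upwards [ae_restrict_of_ae hA.bounded] with y hy
  simpa using hy j k

theorem IsAdmissible.integrable_form (hA : IsAdmissible α β A)
    (f g : Fin d → Lp ℂ 2 (cellMeasure d)) :
    Integrable (fun y => ∑ j, ∑ k, (A y j k : ℂ) * f k y * conj (g j y)) (cellMeasure d) :=
  integrable_finsetSum _ fun j _ => integrable_finsetSum _ fun k _ =>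
    hA.integrable_entry j k (f k) (g j)

/-- Ellipticity is assumed for real vectors only. Applying it to real and imaginary parts separately
extends it to complex vectors. -/
theorem re_quadratic_eq (a : Matrix (Fin d) (Fin d) ℝ) (z : Fin d → ℂ) :
    (∑ j, ∑ k, (a j k : ℂ) * z k * conj (z j)).re =
      ∑ j, ∑ k, a j k * (z k).re * (z j).re + ∑ j, ∑ k, a j k * (z k).im * (z j).im := by
  rw [Complex.re_sum, ← Finset.sum_add_distrib]
  refine Finset.sum_congr rfl fun j _ => ?_
  rw [Complex.re_sum, ← Finset.sum_add_distrib]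
  refine Finset.sum_congr rfl fun k _ => ?_
  simp

/-- Each product `‖z k‖ ‖z j‖` is at most half the sum of the squares, and every square occurs `d`
times in each half of the double sum. The absolute value `|b|` keeps the bound meaningful whatever
the sign of `b`. -/
theorem re_quadratic_le (a : Matrix (Fin d) (Fin d) ℝ) {b : ℝ} (ha : ∀ j k, |a j k| ≤ b)
    (z : Fin d → ℂ) :
    (∑ j, ∑ k, (a j k : ℂ) * z k * conj (z j)).re ≤ |b| * d * ∑ j, ‖z j‖ ^ 2 := by
  have h1 : (∑ j, ∑ k, (a j k : ℂ) * z k * conj (z j)).re ≤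
      ∑ j, ∑ k, |b| * ((‖z k‖ ^ 2 + ‖z j‖ ^ 2) / 2) := by
    refine (Complex.re_le_norm _).trans ((norm_sum_le _ _).trans (Finset.sum_le_sum fun j _ =>
      (norm_sum_le _ _).trans (Finset.sum_le_sum fun k _ => ?_)))
    rw [norm_mul, norm_mul, Complex.norm_real, Real.norm_eq_abs, RCLike.norm_conj, mul_assoc]
    refine mul_le_mul ((ha j k).trans (le_abs_self b)) ?_ (by positivity) (abs_nonneg b)
    nlinarith [sq_nonneg (‖z k‖ - ‖z j‖)]
  refine h1.trans (le_of_eq ?_)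
  simp only [← Finset.mul_sum, ← Finset.sum_div, Finset.sum_add_distrib, Finset.sum_const,
    Finset.card_univ, Fintype.card_fin, nsmul_eq_mul]
  ring

theorem norm_Lp_sq (f : Lp ℂ 2 (cellMeasure d)) : ‖f‖ ^ 2 = ∫ y in cell d, ‖f y‖ ^ 2 := by
  rw [← inner_self_eq_norm_sq (𝕜 := ℂ) f, L2.inner_def, ← integral_re (L2.integrable_inner f f)]
  exact integral_congr_ae (Eventually.of_forall fun y => inner_self_eq_norm_sq (𝕜 := ℂ) (f y))

theorem integrable_norm_Lp_sq (f : Lp ℂ 2 (cellMeasure d)) :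
    Integrable (fun y => ‖f y‖ ^ 2) (cellMeasure d) :=
  (memLp_two_iff_integrable_sq_norm (Lp.memLp f).1).mp (Lp.memLp f)

theorem sum_norm_Lp_sq (f : Fin d → Lp ℂ 2 (cellMeasure d)) :
    ∑ j, ‖f j‖ ^ 2 = ∫ y in cell d, ∑ j, ‖f j y‖ ^ 2 := by
  rw [integral_finsetSum _ fun j _ => integrable_norm_Lp_sq (f j)]
  exact Finset.sum_congr rfl fun j _ => norm_Lp_sq (f j)

theorem IsAdmissible.le_re_form (hA : IsAdmissible α β A) (f : Fin d → Lp ℂ 2 (cellMeasure d)) :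
    α * ∑ j, ‖f j‖ ^ 2 ≤
      (∫ y in cell d, ∑ j, ∑ k, (A y j k : ℂ) * f k y * conj (f j y)).re := by
  rw [sum_norm_Lp_sq, ← integral_const_mul]
  rw [← RCLike.re_to_complex, ← integral_re (hA.integrable_form f f)]
  refine integral_mono_ae ((integrable_finsetSum _ fun j _ =>
    integrable_norm_Lp_sq (f j)).const_mul α) (hA.integrable_form f f).re ?_
  filter_upwards [ae_restrict_of_ae hA.elliptic] with y hy
  simp only [RCLike.re_to_complex]
  rw [re_quadratic_eq]
  have h1 := hy fun j => (f j y).re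
  have h2 := hy fun j => (f j y).im
  have h3 : ∀ z : ℂ, ‖z‖ ^ 2 = z.re ^ 2 + z.im ^ 2 := fun z => by
    rw [← Complex.normSq_eq_norm_sq, Complex.normSq_apply]; ring
  simp only [h3, Finset.sum_add_distrib, mul_add]
  linarith

theorem IsAdmissible.re_form_le (hA : IsAdmissible α β A) (f : Fin d → Lp ℂ 2 (cellMeasure d)) :
    (∫ y in cell d, ∑ j, ∑ k, (A y j k : ℂ) * f k y * conj (f j y)).re ≤
      |β| * d * ∑ j, ‖f j‖ ^ 2 := by
  rw [sum_norm_Lp_sq, ← integral_const_mul]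
  rw [← RCLike.re_to_complex, ← integral_re (hA.integrable_form f f)]
  refine integral_mono_ae (hA.integrable_form f f).re ((integrable_finsetSum _ fun j _ =>
    integrable_norm_Lp_sq (f j)).const_mul _) ?_
  filter_upwards [ae_restrict_of_ae hA.bounded] with y hy
  exact re_quadratic_le (A y) hy fun j => f j y

theorem shiftedForm_eq (A : E d → Matrix (Fin d) (Fin d) ℝ) (ρ : ℝ) (η : E d) (u v : h2Per d) :
    shiftedForm A ρ η u v =
      (∫ y in cell d, ∑ j, ∑ k, (A y j k : ℂ) * shiftedPartialₗ η k u y *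
        conj (shiftedPartialₗ η j v y)) +
      (ρ : ℂ) ^ 2 * inner ℂ (shiftedLaplacianₗ η v) (shiftedLaplacianₗ η u) := by
  rw [inner_Lp]
  rfl

/-- Symmetry of `A` enters here: conjugation exchanges the roles of `j` and `k`, and the transposed
entry is the same real number. -/
theorem IsAdmissible.shiftedForm_conj (hA : IsAdmissible α β A) (ρ : ℝ) (η : E d)
    (u v : h2Per d) : shiftedForm A ρ η u v = conj (shiftedForm A ρ η v u) := by
  rw [shiftedForm_eq, shiftedForm_eq, map_add, map_mul, inner_conj_symm, map_pow,
    Complex.conj_ofReal, ← integral_conj]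
  congr 1
  refine integral_congr_ae ?_
  filter_upwards [ae_restrict_of_ae hA.symm] with y hy
  simp only [map_sum, map_mul, Complex.conj_conj, Complex.conj_ofReal]
  rw [Finset.sum_comm]
  refine Finset.sum_congr rfl fun j _ => Finset.sum_congr rfl fun k _ => ?_
  rw [← hy.apply j k]
  ring

theorem IsAdmissible.shiftedForm_add (hA : IsAdmissible α β A) (ρ : ℝ) (η : E d)
    (u v w : h2Per d) :
    shiftedForm A ρ η (u + v : h2Per d) w = shiftedForm A ρ η u w + shiftedForm A ρ η v w := by
  simp only [shiftedForm_eq]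
  rw [map_add, inner_add_right, mul_add, add_add_add_comm,
    ← integral_add (hA.integrable_form _ _) (hA.integrable_form _ _)]
  congr 1
  refine integral_congr_ae ?_
  have h : ∀ᵐ y ∂(cellMeasure d), ∀ k, shiftedPartialₗ η k (u + v) y =
      shiftedPartialₗ η k u y + shiftedPartialₗ η k v y := by
    rw [ae_all_iff]
    intro k
    rw [map_add]
    exact Lp.coeFn_add _ _
  filter_upwards [h] with y hy
  simp only [hy, mul_add, add_mul, Finset.sum_add_distrib]

theorem shiftedForm_smul (A : E d → Matrix (Fin d) (Fin d) ℝ) (ρ : ℝ) (η : E d)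
    (a : ℂ) (u w : h2Per d) :
    shiftedForm A ρ η (a • u : h2Per d) w = a * shiftedForm A ρ η u w := by
  simp only [shiftedForm_eq]
  rw [map_smul, inner_smul_right, mul_add, ← integral_const_mul, mul_left_comm]
  congr 1
  refine integral_congr_ae ?_
  have h : ∀ᵐ y ∂(cellMeasure d), ∀ k, shiftedPartialₗ η k (a • u) y =
      a * shiftedPartialₗ η k u y := by
    rw [ae_all_iff]
    intro k
    rw [map_smul]
    exact Lp.coeFn_smul _ _
  filter_upwards [h] with y hy
  simp only [hy, Finset.mul_sum]
  refine Finset.sum_congr rfl fun j _ => Finset.sum_congr rfl fun k _ => ?_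
  ring

/-- The form of the operator as a sesquilinear map, conjugate linear in the first variable. -/
def IsAdmissible.sesqForm (hA : IsAdmissible α β A) (ρ : ℝ) (η : E d) :
    h2Per d →ₗ⋆[ℂ] h2Per d →ₗ[ℂ] ℂ :=
  LinearMap.mk₂'ₛₗ (starRingEnd ℂ) (RingHom.id ℂ) (fun v u => shiftedForm A ρ η u v)
    -- Conjugate linearity in the test function is deduced from linearity in the other argument by
    -- Hermitian symmetry.
    (fun v w u => by
      rw [hA.shiftedForm_conj, hA.shiftedForm_add, map_add, ← hA.shiftedForm_conj,
        ← hA.shiftedForm_conj])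
    (fun a v u => by
      rw [hA.shiftedForm_conj, shiftedForm_smul, map_mul, ← hA.shiftedForm_conj, smul_eq_mul])
    (fun w u v => hA.shiftedForm_add ρ η u v w)
    (fun a v u => shiftedForm_smul A ρ η a u v)

/-- The fourth-order term is nonnegative and is dropped, which makes the lower bound independent of
`ρ`. -/
theorem IsAdmissible.le_re_shiftedForm (hA : IsAdmissible α β A) (ρ : ℝ) (η : E d)
    (u : h2Per d) :
    α * ∑ j, ‖shiftedPartial η j u‖ ^ 2 ≤ (shiftedForm A ρ η u u).re := by
  rw [shiftedForm_eq, inner_self_eq_norm_sq_to_K, Complex.add_re]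
  have h := hA.le_re_form fun j => shiftedPartialₗ η j u
  have h2 : 0 ≤ ((ρ : ℂ) ^ 2 * (‖shiftedLaplacianₗ η u‖ : ℂ) ^ 2).re := by
    have : (ρ : ℂ) ^ 2 * (‖shiftedLaplacianₗ η u‖ : ℂ) ^ 2 =
      ((ρ ^ 2 * ‖shiftedLaplacianₗ η u‖ ^ 2 : ℝ) : ℂ) := by push_cast; rfl
    rw [this, Complex.ofReal_re]
    positivity
  exact h.trans (le_add_of_nonneg_right h2)

theorem IsAdmissible.re_shiftedForm_le (hA : IsAdmissible α β A) (ρ : ℝ) (η : E d)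
    (u : h2Per d) :
    (shiftedForm A ρ η u u).re ≤
      |β| * d * ∑ j, ‖shiftedPartial η j u‖ ^ 2 + ρ ^ 2 * ‖shiftedLaplacian η u‖ ^ 2 := by
  rw [shiftedForm_eq, inner_self_eq_norm_sq_to_K, Complex.add_re]
  have h := hA.re_form_le fun j => shiftedPartialₗ η j u
  have : (ρ : ℂ) ^ 2 * (‖shiftedLaplacianₗ η u‖ : ℂ) ^ 2 =
      ((ρ ^ 2 * ‖shiftedLaplacianₗ η u‖ ^ 2 : ℝ) : ℂ) := by push_cast; rfl
  refine add_le_add h (le_of_eq ?_)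
  rw [← Complex.ofReal_re (ρ ^ 2 * ‖shiftedLaplacian η u‖ ^ 2)]
  exact congrArg Complex.re this

end Form

/-! ### The spectral gap -/

section Gap

variable {d : ℕ} {α β ρ : ℝ} {A : E d → Matrix (Fin d) (Fin d) ℝ} {lam : ℕ → E d → ℝ}
  {φ : ℕ → E d → E d → ℂ} {η : E d}

theorem sum_norm_shiftedPartial_sq (η : E d) (u : h2Per d) :
    HasSum (fun n : Fin d → ℤ => cellVol d * ((∑ j, ((n j : ℝ) + η j) ^ 2) *
      ‖fourierCoeffPer u n‖ ^ 2)) (∑ j, ‖shiftedPartial η j u‖ ^ 2) := by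
  have h : ∀ j ∈ Finset.univ, HasSum (fun n : Fin d → ℤ => cellVol d *
      ‖Complex.I * (((n j : ℝ) + η j : ℝ) : ℂ) * fourierCoeffPer u n‖ ^ 2)
      (‖shiftedPartial η j u‖ ^ 2) := fun j _ =>
    norm_fourierSeries_sq (u.2.summable_shiftedPartial η j)
  refine (hasSum_sum h).congr_fun fun n => ?_
  rw [Finset.sum_mul, Finset.mul_sum]
  refine Finset.sum_congr rfl fun j _ => ?_
  rw [norm_mul, norm_mul, Complex.norm_I, one_mul, Complex.norm_real, Real.norm_eq_abs, mul_pow,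
    sq_abs]

/-- Some coordinate of `n` has modulus at least `1`, while the coordinates of `η` have modulus at
most `1/2`. That coordinate of `n + η` alone contributes at least `1/4`. -/
theorem quarter_le_sum_add_sq (hη : η ∈ dualCell d) {n : Fin d → ℤ} (hn : n ≠ 0) :
    1 / 4 ≤ ∑ j, ((n j : ℝ) + η j) ^ 2 := by
  obtain ⟨j, hj⟩ := Function.ne_iff.mp hn
  have h1 : ((n j : ℝ) + η j) ^ 2 ≤ ∑ j, ((n j : ℝ) + η j) ^ 2 :=
    Finset.single_le_sum (f := fun j => ((n j : ℝ) + η j) ^ 2) (fun i _ => sq_nonneg _)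
      (Finset.mem_univ j)
  refine le_trans ?_ h1
  obtain ⟨h2, h3⟩ := hη j
  rcases lt_or_gt_of_ne hj with h | h
  · have h4 : (n j : ℝ) ≤ -1 := by
      have : n j ≤ -1 := by simp at h; omega
      exact_mod_cast this
    nlinarith
  · have h4 : (1 : ℝ) ≤ n j := by
      have : 1 ≤ n j := by simp at h; omega
      exact_mod_cast this
    nlinarith

/-- Poincaré's inequality for shifted gradients of functions of zero mean. -/
theorem norm_sq_le_of_fourierCoeffPer_zero (hη : η ∈ dualCell d) (u : h2Per d)
    (hu : fourierCoeffPer u.1 0 = 0) :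
    ‖h2PerToLp d u‖ ^ 2 ≤ 4 * ∑ j, ‖shiftedPartial η j u‖ ^ 2 := by
  refine hasSum_le (fun n => ?_) (hasSum_norm_fourierCoeffPer_sq u.2.memLp)
    ((sum_norm_shiftedPartial_sq η u).mul_left 4)
  by_cases hn : n = 0
  · subst hn
    simp [hu]
  · have h := quarter_le_sum_add_sq hη hn
    have h2 := cellVol_pos d
    rw [mul_left_comm]
    refine mul_le_mul_of_nonneg_left ?_ h2.le
    rw [← mul_assoc]
    refine le_mul_of_one_le_left (by positivity) (by linarith)

/-- The Bloch eigenfunctions as elements of the space of periodic `H²` functions. -/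
def IsBlochSystem.mode (hB : IsBlochSystem A ρ lam φ) (hη : η ∈ dualCell d) (m : ℕ) : h2Per d :=
  ⟨fun y => φ m y η, hB.memH2 η hη m⟩

theorem IsBlochSystem.orthonormal_mode (hB : IsBlochSystem A ρ lam φ) (hη : η ∈ dualCell d) :
    Orthonormal ℂ (h2PerToLp d ∘ hB.mode hη) := by
  rw [orthonormal_iff_ite]
  intro m n
  have h := hB.orthonormal η hη n m
  simp only [Function.comp_apply]
  change inner ℂ ((hB.memH2 η hη m).memLp.toLp _) ((hB.memH2 η hη n).memLp.toLp _) = _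
  rw [inner_toLp, h]
  simp only [eq_comm]

theorem IsBlochSystem.sesqForm_mode (hA : IsAdmissible α β A) (hB : IsBlochSystem A ρ lam φ)
    (hη : η ∈ dualCell d) (m : ℕ) (ψ : h2Per d) :
    hA.sesqForm ρ η ψ (hB.mode hη m) =
      lam m η * inner ℂ (h2PerToLp d ψ) (h2PerToLp d (hB.mode hη m)) := by
  have h := hB.eigen η hη m ψ.1 ψ.2
  change _ = _ * inner ℂ (ψ.2.memLp.toLp _) ((hB.memH2 η hη m).memLp.toLp _)
  rw [inner_toLp, ← h]
  rfl

theorem IsAdmissible.sesqForm_nonneg (hA : IsAdmissible α β A) (u : h2Per d) :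
    0 ≤ (hA.sesqForm ρ η u u).re := by
  refine le_trans ?_ (hA.le_re_shiftedForm ρ η u)
  have := hA.pos
  positivity

/-- All eigenvalues other than the first one are bounded below, uniformly in `ρ` and `η`. -/
theorem IsBlochSystem.le_eigenvalue (hA : IsAdmissible α β A) (hB : IsBlochSystem A ρ lam φ)
    (hη : η ∈ dualCell d) {m : ℕ} (hm : 1 ≤ m) : α / 4 ≤ lam m η := by
  refine le_trans ?_ (hB.mono η hη hm)
  set p := hB.mode hη 0 with hp
  set q := hB.mode hη 1 with hq
  -- The mean is a single linear functional, so it vanishes on some nonzero element of the span of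
  -- the first two modes. This is the min-max argument for the second eigenvalue.
  obtain ⟨a, b, hab, h0⟩ : ∃ a b : ℂ, (a ≠ 0 ∨ b ≠ 0) ∧
      a * fourierCoeffPer p.1 0 + b * fourierCoeffPer q.1 0 = 0 := by
    by_cases h : fourierCoeffPer p.1 0 = 0
    · exact ⟨1, 0, Or.inl one_ne_zero, by simp [h]⟩
    · exact ⟨-fourierCoeffPer q.1 0, fourierCoeffPer p.1 0, Or.inr h, by ring⟩
  set w := a • p + b • q with hw
  have hw0 : fourierCoeffPer w.1 0 = 0 := by
    rw [hw, Submodule.coe_add, fourierCoeffPer_add (a • p).2.memLp (b • q).2.memLp,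
      Submodule.coe_smul, Submodule.coe_smul, fourierCoeffPer_smul, fourierCoeffPer_smul, h0]
  have ho := orthonormal_iff_ite.mp (hB.orthonormal_mode hη)
  have hpp := ho 0 0
  have hpq := ho 0 1
  have hqp := ho 1 0
  have hqq := ho 1 1
  simp only [Function.comp_apply, ← hp, ← hq] at hpp hpq hqp hqq
  rw [if_pos trivial] at hpp hqq
  rw [if_neg (by norm_num)] at hpq hqp
  have ewp : inner ℂ (h2PerToLp d w) (h2PerToLp d p) = conj a := by
    rw [hw, map_add, map_smul, map_smul, inner_add_left, inner_smul_left, inner_smul_left,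
      hpp, hqp]
    simp
  have ewq : inner ℂ (h2PerToLp d w) (h2PerToLp d q) = conj b := by
    rw [hw, map_add, map_smul, map_smul, inner_add_left, inner_smul_left, inner_smul_left,
      hqq, hpq]
    simp
  have hn : ‖h2PerToLp d w‖ ^ 2 = ‖a‖ ^ 2 + ‖b‖ ^ 2 := by
    rw [← inner_self_eq_norm_sq (𝕜 := ℂ)]
    conv_lhs => rw [hw, map_add, map_smul, map_smul, inner_add_right, inner_smul_right,
      inner_smul_right, ← map_smul, ← map_smul, ← map_add, ← hw, ewp, ewq]
    rw [Complex.mul_conj, Complex.mul_conj, Complex.normSq_eq_norm_sq, Complex.normSq_eq_norm_sq,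
      ← Complex.ofReal_add]
    exact Complex.ofReal_re _
  have hf : (hA.sesqForm ρ η w w).re = lam 0 η * ‖a‖ ^ 2 + lam 1 η * ‖b‖ ^ 2 := by
    have : hA.sesqForm ρ η w w = ((lam 0 η * ‖a‖ ^ 2 + lam 1 η * ‖b‖ ^ 2 : ℝ) : ℂ) := by
      have e : hA.sesqForm ρ η w w = a * (lam 0 η * conj a) + b * (lam 1 η * conj b) := by
        conv_lhs => rw [hw, map_add, map_smul, map_smul, ← hw]
        rw [hp, hq, hB.sesqForm_mode hA hη, hB.sesqForm_mode hA hη, ← hp, ← hq, ewp, ewq]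
        rfl
      rw [e, mul_left_comm, mul_left_comm b, Complex.mul_conj, Complex.mul_conj,
        Complex.normSq_eq_norm_sq, Complex.normSq_eq_norm_sq]
      push_cast
      rfl
    rw [this, Complex.ofReal_re]
  have h1 := norm_sq_le_of_fourierCoeffPer_zero hη w hw0
  have h2 : α * ∑ j, ‖shiftedPartial η j w‖ ^ 2 ≤ (hA.sesqForm ρ η w w).re :=
    hA.le_re_shiftedForm ρ η w
  have h3 := hB.mono η hη zero_le_one
  simp only at h3
  have hpos := hA.pos
  have hab' : 0 < ‖a‖ ^ 2 + ‖b‖ ^ 2 := by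
    rcases hab with h | h
    · have := norm_pos_iff.mpr h
      positivity
    · have := norm_pos_iff.mpr h
      positivity
  rw [hf] at h2
  rw [hn] at h1
  -- The chain is `(α/4) ‖w‖² ≤ α ∑ ‖(∂_j + iη_j) w‖² ≤ Q(w, w) = λ₀ |a|² + λ₁ |b|² ≤ λ₁ (|a|² +
  -- |b|²)`, with `‖w‖² = |a|² + |b|²`.
  refine le_of_mul_le_mul_right ?_ hab'
  nlinarith [mul_le_mul_of_nonneg_left h1 hpos.le, sq_nonneg ‖a‖,
    mul_le_mul_of_nonneg_right h3 (sq_nonneg ‖a‖)]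

/-- Contribution of the higher modes to the `L²` norm of a periodic `H²` function. -/
theorem IsBlochSystem.sum_norm_inner_sq_le (hA : IsAdmissible α β A)
    (hB : IsBlochSystem A ρ lam φ) (hη : η ∈ dualCell d) (w : h2Per d) (N : ℕ) :
    ∑ m ∈ Finset.Icc 1 N, ‖inner ℂ (h2PerToLp d (hB.mode hη m)) (h2PerToLp d w)‖ ^ 2 ≤
      4 / α * (|β| * d * ∑ j, ‖shiftedPartial η j w‖ ^ 2 +
        ρ ^ 2 * ‖shiftedLaplacian η w‖ ^ 2) := by
  have h := sum_eigenvalue_mul_norm_sq_le (h2PerToLp d) (hA.sesqForm ρ η)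
    (fun u v => hA.shiftedForm_conj ρ η v u) hA.sesqForm_nonneg (hB.mode hη)
    (hB.orthonormal_mode hη) (fun m => lam m η) (fun m ψ => hB.sesqForm_mode hA hη m ψ)
    (Finset.Icc 1 N) w
  have h2 : (hA.sesqForm ρ η w w).re ≤ _ := hA.re_shiftedForm_le ρ η w
  have hpos := hA.pos
  have h3 : α / 4 * ∑ m ∈ Finset.Icc 1 N,
      ‖inner ℂ (h2PerToLp d (hB.mode hη m)) (h2PerToLp d w)‖ ^ 2 ≤
      ∑ m ∈ Finset.Icc 1 N, lam m η *
        ‖inner ℂ (h2PerToLp d (hB.mode hη m)) (h2PerToLp d w)‖ ^ 2 := by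
    rw [Finset.mul_sum]
    exact Finset.sum_le_sum fun m hm => mul_le_mul_of_nonneg_right
      (hB.le_eigenvalue hA hη (Finset.mem_Icc.mp hm).1) (by positivity)
  have h4 := (h3.trans h).trans h2
  rw [div_mul_eq_mul_div, le_div_iff₀ hpos]
  linarith

end Gap

/-! ### The Fourier transform on the whole space -/

open scoped FourierTransform

/-- The Fourier transform `ζ ↦ ∫ u(x) e^{-i x · ζ} dx` of `u ∈ L²(ℝ^d)`. -/
def angularFourier {d : ℕ} (u : L2 d) (ζ : E d) : ℂ := (𝓕 u : L2 d) ((2 * Real.pi)⁻¹ • ζ)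

/-- Elements of `L²` are evaluated at dilated points below. This allows almost-everywhere identities
to be composed with the dilation. -/
theorem quasiMeasurePreserving_smul {d : ℕ} {r : ℝ} (hr : r ≠ 0) :
    Measure.QuasiMeasurePreserving (fun ζ : E d => r • ζ) volume volume := by
  refine ⟨by fun_prop, ?_⟩
  rw [Measure.map_addHaar_smul _ hr]
  exact Measure.smul_absolutelyContinuous

theorem two_pi_inv_ne_zero : (2 * Real.pi)⁻¹ ≠ 0 := by positivity

/-- Turns an identity of tempered distributions into a pointwise one: smooth compactly supported
test functions are Schwartz and already separate locally integrable functions. -/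
theorem ae_eq_of_forall_schwartz {d : ℕ} {f g : E d → ℂ} (hf : LocallyIntegrable f)
    (hg : LocallyIntegrable g) (h : ∀ ψ : 𝓢(E d, ℂ), ∫ x, ψ x • f x = ∫ x, ψ x • g x) :
    f =ᵐ[volume] g := by
  refine ae_eq_of_integral_contDiff_smul_eq hf hg fun k hk hc => ?_
  have hg₁ : HasCompactSupport (Complex.ofRealCLM ∘ k) := hc.comp_left rfl
  have hg₂ : ContDiff ℝ (⊤ : ℕ∞) (Complex.ofRealCLM ∘ k) := by fun_prop
  have h1 := h (hg₁.toSchwartzMap hg₂)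
  simpa using h1

theorem locallyIntegrable_mul_Lp {d : ℕ} {p : E d → ℂ} (hp : Continuous p) (u : L2 d) :
    LocallyIntegrable (fun x => p x * u x) :=
  ((Lp.memLp u).locallyIntegrable one_le_two).continuous_smul hp

theorem tempered_smul_apply {d : ℕ} (a : ℂ) (T : 𝓢'(E d, ℂ)) (ψ : 𝓢(E d, ℂ)) :
    (a • T) ψ = a * T ψ := rfl

/-- The Fourier transform turns the distributional derivative into multiplication by `2πi ξ_j`. Both
sides are locally integrable functions, so equality as distributions gives equality almost
everywhere. -/
theorem IsPartial.fourier_ae_eq {d : ℕ} {j : Fin d} {u g : L2 d} (h : IsPartial j u g) :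
    (𝓕 g : L2 d) =ᵐ[volume] fun ξ => (2 * Real.pi * Complex.I * (ξ j : ℂ)) * (𝓕 u : L2 d) ξ := by
  have hT : ((𝓕 g : L2 d) : 𝓢'(E d, ℂ)) = (2 * Real.pi * Complex.I) •
      TemperedDistribution.smulLeftCLM ℂ (inner ℝ · (EuclideanSpace.single j (1 : ℝ)))
        ((𝓕 u : L2 d) : 𝓢'(E d, ℂ)) := by
    rw [← Lp.fourier_toTemperedDistribution_eq, ← Lp.fourier_toTemperedDistribution_eq,
      ← TemperedDistribution.fourier_lineDerivOp_eq, ← h]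
  refine ae_eq_of_forall_schwartz ((Lp.memLp _).locallyIntegrable one_le_two)
    (locallyIntegrable_mul_Lp (by fun_prop) _) fun ψ => ?_
  have h1 := congrArg (fun T : 𝓢'(E d, ℂ) => T ψ) hT
  have hg : Function.HasTemperateGrowth fun x : E d =>
    (Complex.ofReal (inner ℝ x (EuclideanSpace.single j (1 : ℝ)))) := by fun_prop
  simp only [Lp.toTemperedDistribution_apply] at h1
  rw [h1]
  rw [tempered_smul_apply, TemperedDistribution.smulLeftCLM_apply_apply, Lp.toTemperedDistribution_apply,
    ← integral_const_mul]
  refine integral_congr_ae (Eventually.of_forall fun ξ => ?_)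
  simp only [SchwartzMap.smulLeftCLM_apply_apply hg]
  simp only [smul_eq_mul, EuclideanSpace.inner_single_right]
  simp
  ring

theorem IsLaplacian.fourier_ae_eq {d : ℕ} {u g : L2 d} (h : IsLaplacian u g) :
    (𝓕 g : L2 d) =ᵐ[volume]
      fun ξ => (-((2 * Real.pi) ^ 2 * ‖ξ‖ ^ 2 : ℝ) : ℂ) * (𝓕 u : L2 d) ξ := by
  have hT : ((𝓕 g : L2 d) : 𝓢'(E d, ℂ)) = ((-(2 * Real.pi) ^ 2 : ℝ) : ℂ) •
      TemperedDistribution.smulLeftCLM ℂ (fun x : E d => Complex.ofReal (‖x‖ ^ 2))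
        ((𝓕 u : L2 d) : 𝓢'(E d, ℂ)) := by
    rw [← Lp.fourier_toTemperedDistribution_eq, ← Lp.fourier_toTemperedDistribution_eq, h,
      TemperedDistribution.laplacian_eq_fourierMultiplierCLM, ← Complex.coe_smul,
      FourierTransform.fourier_smul,
      TemperedDistribution.fourierMultiplierCLM_apply, FourierTransform.fourier_fourierInv_eq]
  refine ae_eq_of_forall_schwartz ((Lp.memLp _).locallyIntegrable one_le_two)
    (locallyIntegrable_mul_Lp (by fun_prop) _) fun ψ => ?_
  have h1 := congrArg (fun T : 𝓢'(E d, ℂ) => T ψ) hT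
  have hg : Function.HasTemperateGrowth fun x : E d => Complex.ofReal (‖x‖ ^ 2) := by fun_prop
  simp only [Lp.toTemperedDistribution_apply] at h1
  rw [h1]
  rw [tempered_smul_apply, TemperedDistribution.smulLeftCLM_apply_apply, Lp.toTemperedDistribution_apply,
    ← integral_const_mul]
  refine integral_congr_ae (Eventually.of_forall fun ξ => ?_)
  simp only [SchwartzMap.smulLeftCLM_apply_apply hg, smul_eq_mul]
  push_cast
  ring

theorem IsPartial.angularFourier_ae_eq {d : ℕ} {j : Fin d} {u g : L2 d} (h : IsPartial j u g) :
    ∀ᵐ ζ, angularFourier g ζ = Complex.I * (ζ j : ℂ) * angularFourier u ζ := by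
  filter_upwards [(quasiMeasurePreserving_smul two_pi_inv_ne_zero).ae h.fourier_ae_eq] with ζ hζ
  unfold angularFourier
  rw [hζ]
  have : (Real.pi : ℂ) ≠ 0 := by exact_mod_cast Real.pi_ne_zero
  simp only [PiLp.smul_apply, smul_eq_mul]
  push_cast
  field_simp

theorem IsLaplacian.angularFourier_ae_eq {d : ℕ} {u g : L2 d} (h : IsLaplacian u g) :
    ∀ᵐ ζ : E d, angularFourier g ζ = -((∑ j, ζ j ^ 2 : ℝ) : ℂ) * angularFourier u ζ := by
  filter_upwards [(quasiMeasurePreserving_smul two_pi_inv_ne_zero).ae h.fourier_ae_eq] with ζ hζ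
  unfold angularFourier
  rw [hζ]
  congr 3
  rw [norm_smul, mul_pow ‖_‖, EuclideanSpace.norm_sq_eq, ← mul_assoc, ← mul_pow]
  simp only [Real.norm_eq_abs, sq_abs, abs_inv]
  have := Real.two_pi_pos
  rw [abs_of_pos this, mul_inv_cancel₀ this.ne', one_pow, one_mul]

theorem aestronglyMeasurable_angularFourier {d : ℕ} (u : L2 d) :
    AEStronglyMeasurable (angularFourier u) volume :=
  (Lp.memLp (𝓕 u : L2 d)).1.comp_quasiMeasurePreserving
    (quasiMeasurePreserving_smul two_pi_inv_ne_zero)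

/-! ### Plancherel's theorem and agreement with the integral formula. -/

theorem lintegral_enorm_sq_Lp {X : Type*} [MeasurableSpace X] {μ : Measure X} (u : Lp ℂ 2 μ) :
    ∫⁻ x, ‖u x‖ₑ ^ 2 ∂μ = ENNReal.ofReal (‖u‖ ^ 2) := by
  have h := (Lp.memLp u).2
  rw [Lp.norm_def, ← ENNReal.toReal_pow, ENNReal.ofReal_toReal (by finiteness),
    eLpNorm_eq_lintegral_rpow_enorm_toReal two_ne_zero ENNReal.ofNat_ne_top, ← ENNReal.rpow_natCast,
    ← ENNReal.rpow_mul]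
  simp

/-- Plancherel's theorem. -/
theorem lintegral_enorm_angularFourier_sq {d : ℕ} (u : L2 d) :
    ∫⁻ ζ, ‖angularFourier u ζ‖ₑ ^ 2 = ENNReal.ofReal (cellVol d * ‖u‖ ^ 2) := by
  have h2 : (fun ζ : E d => ‖angularFourier u ζ‖ₑ ^ 2) =
      fun ζ => (fun x => ‖(𝓕 u : L2 d) x‖ₑ ^ 2) ((2 * Real.pi)⁻¹ • ζ) := rfl
  have hm : AEMeasurable (fun x => ‖(𝓕 u : L2 d) x‖ₑ ^ 2)
      (Measure.map (fun ζ : E d => (2 * Real.pi)⁻¹ • ζ) volume) := by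
    rw [Measure.map_addHaar_smul _ two_pi_inv_ne_zero]
    exact ((Lp.aestronglyMeasurable (𝓕 u : L2 d)).enorm.pow_const 2).smul_measure _
  rw [h2, ← lintegral_map' hm (by fun_prop), Measure.map_addHaar_smul _ two_pi_inv_ne_zero,
    lintegral_smul_measure, lintegral_enorm_sq_Lp, Lp.norm_fourier_eq, smul_eq_mul,
    ← ENNReal.ofReal_mul (abs_nonneg _)]
  congr 2
  rw [finrank_euclideanSpace_fin, inv_pow, inv_inv, abs_of_pos (by positivity)]
  rfl

/-- On `L¹ ∩ L²` the `L²` transform agrees with the integral: against a Schwartz function, the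
transform moves from one factor to the other in both definitions. -/
theorem fourier_toLp_ae_eq {d : ℕ} {h : E d → ℂ} (h1 : Integrable h) (h2 : MemLp h 2) :
    (𝓕 (h2.toLp h) : L2 d) =ᵐ[volume] 𝓕 h := by
  have hc : Continuous (𝓕 h) := by
    exact VectorFourier.fourierIntegral_continuous Real.continuous_fourierChar
      continuous_inner h1
  refine ae_eq_of_forall_schwartz ((Lp.memLp _).locallyIntegrable one_le_two)
    hc.locallyIntegrable fun ψ => ?_
  have e := congrArg (fun T : 𝓢'(E d, ℂ) => T ψ)
    (Lp.fourier_toTemperedDistribution_eq (h2.toLp h))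
  simp only [Lp.toTemperedDistribution_apply, TemperedDistribution.fourier_apply] at e
  rw [← e]
  have f := VectorFourier.integral_fourierIntegral_smul_eq_flip (L := innerₗ (E d))
    (f := ψ) (g := h) (μ := volume) (ν := volume) Real.continuous_fourierChar continuous_inner
    ψ.integrable h1
  rw [flip_innerₗ] at f
  refine Eq.trans ?_ f
  refine integral_congr_ae ?_
  filter_upwards [h2.coeFn_toLp] with x hx
  rw [hx]
  rfl

theorem angularFourier_toLp_ae_eq {d : ℕ} {h : E d → ℂ} (h1 : Integrable h) (h2 : MemLp h 2) :
    ∀ᵐ ζ, angularFourier (h2.toLp h) ζ = ∫ x, h x * conj (planeWave x ζ) := by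
  filter_upwards [(quasiMeasurePreserving_smul two_pi_inv_ne_zero).ae
    (fourier_toLp_ae_eq h1 h2)] with ζ hζ
  unfold angularFourier
  rw [hζ, Real.fourier_eq']
  refine integral_congr_ae (Eventually.of_forall fun x => ?_)
  simp only [smul_eq_mul]
  rw [mul_comm]
  congr 1
  unfold planeWave
  rw [← Complex.exp_conj, map_mul, Complex.conj_I, Complex.conj_ofReal]
  congr 1
  rw [inner_smul_right, PiLp.inner_apply]
  have : (Real.pi : ℂ) ≠ 0 := by exact_mod_cast Real.pi_ne_zero
  simp only [RCLike.inner_apply, conj_trivial]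
  push_cast
  simp only [mul_comm]
  field_simp

theorem angularFourier_sub {d : ℕ} (u v : L2 d) :
    ∀ᵐ ζ, angularFourier (u - v) ζ = angularFourier u ζ - angularFourier v ζ := by
  have h : (𝓕 (u - v) : L2 d) =ᵐ[volume] fun x => (𝓕 u : L2 d) x - (𝓕 v : L2 d) x := by
    have e : (𝓕 (u - v) : L2 d) = 𝓕 u - 𝓕 v := (Lp.fourierTransformₗᵢ (E d) ℂ).map_sub u v
    rw [e]
    exact Lp.coeFn_sub _ _
  exact (quasiMeasurePreserving_smul two_pi_inv_ne_zero).ae h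

/-! ### Tiling by the dual cell -/

/-- The lattice point `n / ε`. -/
def latticePoint {d : ℕ} (ε : ℝ) (n : Fin d → ℤ) : E d := WithLp.toLp 2 fun j => ε⁻¹ * (n j : ℝ)

theorem measurableSet_dualCell (d : ℕ) : MeasurableSet (dualCell d) := by
  have : dualCell d = ⋂ i, (fun y : E d => y i) ⁻¹' Set.Ico (-(1 / 2) : ℝ) (1 / 2) := by
    ext; simp [dualCell]
  rw [this]
  exact MeasurableSet.iInter fun i => (by fun_prop : Measurable fun y : E d => y i)
    measurableSet_Ico

theorem measurableSet_scaledDualCell (d : ℕ) (ε : ℝ) : MeasurableSet (scaledDualCell d ε) :=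
  (by fun_prop : Measurable fun ξ : E d => ε • ξ) (measurableSet_dualCell d)

/-- As the cells are half-open, each `ζ` lies in exactly one translate, the one with index `n j = ⌊ε
ζ j + 1/2⌋`. -/
theorem lintegral_eq_tsum_dualCell {d : ℕ} {ε : ℝ} (hε : 0 < ε) (f : E d → ℝ≥0∞) :
    ∫⁻ ζ, f ζ = ∑' n, ∫⁻ ξ in scaledDualCell d ε, f (ξ + latticePoint ε n) := by
  set S : (Fin d → ℤ) → Set (E d) :=
    fun n => (fun ζ => ζ - latticePoint ε n) ⁻¹' scaledDualCell d ε with hS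
  have mem : ∀ n ζ, ζ ∈ S n ↔ ∀ j, n j = ⌊ε * ζ j + 1 / 2⌋ := by
    intro n ζ
    simp only [hS, Set.mem_preimage, scaledDualCell, dualCell, Set.mem_ofPred_eq, Set.mem_Ico]
    refine forall_congr' fun j => ?_
    rw [eq_comm, Int.floor_eq_iff]
    simp only [PiLp.smul_apply, PiLp.sub_apply, latticePoint, smul_eq_mul, mul_sub,
      mul_inv_cancel_left₀ hε.ne']
    constructor <;> rintro ⟨h1, h2⟩ <;> constructor <;> linarith
  have hm : ∀ n, MeasurableSet (S n) := fun n =>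
    (by fun_prop : Measurable fun ζ => ζ - latticePoint ε n) (measurableSet_scaledDualCell d ε)
  have hd : Pairwise (Function.onFun Disjoint S) := by
    intro m n hmn
    refine Set.disjoint_left.mpr fun ζ h1 h2 => hmn ?_
    rw [mem] at h1 h2
    ext j
    rw [h1, h2]
  have hU : ⋃ n, S n = Set.univ := by
    refine Set.eq_univ_of_forall fun ζ => Set.mem_iUnion.mpr ⟨fun j => ⌊ε * ζ j + 1 / 2⌋, ?_⟩
    rw [mem]
    exact fun j => rfl
  rw [← setLIntegral_univ, ← hU, lintegral_iUnion hm hd]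
  refine tsum_congr fun n => ?_
  have hp := (measurePreserving_sub_right volume (latticePoint ε n)).restrict_preimage
    (measurableSet_scaledDualCell d ε)
  have he : MeasurableEmbedding fun ζ : E d => ζ - latticePoint ε n :=
    (MeasurableEquiv.subRight (latticePoint ε n)).measurableEmbedding
  rw [← hp.lintegral_comp_emb he]
  simp [hS]

/-! ### Periodic functions on balls -/

/-- The representative of `y` modulo `2πℤ^d` in the cell. -/
def cellFract {d : ℕ} (y : E d) : E d :=
  y + WithLp.toLp 2 fun j => 2 * Real.pi * ((-⌊y j / (2 * Real.pi)⌋ : ℤ) : ℝ)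

theorem cellFract_apply {d : ℕ} (y : E d) (j : Fin d) :
    cellFract y j = y j - 2 * Real.pi * ⌊y j / (2 * Real.pi)⌋ := by
  simp [cellFract, sub_eq_add_neg]

theorem measurable_cellFract (d : ℕ) : Measurable (cellFract : E d → E d) := by
  unfold cellFract
  refine Measurable.add measurable_id ?_
  refine (WithLp.measurable_toLp 2 (Fin d → ℝ)).comp (measurable_pi_lambda _ fun j => ?_)
  have : Measurable fun y : E d => ⌊y j / (2 * Real.pi)⌋ :=
    Int.measurable_floor.comp (by fun_prop)
  fun_prop

theorem cellFract_mem {d : ℕ} (y : E d) : cellFract y ∈ cell d := by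
  intro j
  have h := Real.two_pi_pos
  rw [cellFract_apply]
  have h1 := Int.floor_le (y j / (2 * Real.pi))
  have h2 := Int.lt_floor_add_one (y j / (2 * Real.pi))
  rw [le_div_iff₀ h] at h1
  rw [div_lt_iff₀ h] at h2
  constructor <;> linarith

theorem floor_eq_of_sub_mem_cell {d : ℕ} {y : E d} {p : Fin d → ℤ}
    (h : y + WithLp.toLp 2 (fun j => 2 * Real.pi * ((-p j : ℤ) : ℝ)) ∈ cell d) (j : Fin d) :
    ⌊y j / (2 * Real.pi)⌋ = p j := by
  have h0 := Real.two_pi_pos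
  have h1 := h j
  simp only [PiLp.add_apply, Set.mem_Ico] at h1
  push_cast at h1
  rw [Int.floor_eq_iff, le_div_iff₀ h0, div_lt_iff₀ h0]
  constructor <;> nlinarith [h1.1, h1.2]

theorem cellFract_eq_of_mem {d : ℕ} {y : E d} (h : y ∈ cell d) : cellFract y = y := by
  have : ∀ j, ⌊y j / (2 * Real.pi)⌋ = 0 := by
    intro j
    exact floor_eq_of_sub_mem_cell (p := fun _ => 0) (by convert h using 1; ext j; simp) j
  ext j
  rw [cellFract_apply, this]
  simp

theorem cellFract_add {d : ℕ} (y : E d) (p : Fin d → ℤ) :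
    cellFract (y + WithLp.toLp 2 fun j => 2 * Real.pi * (p j : ℝ)) = cellFract y := by
  ext j
  rw [cellFract_apply, cellFract_apply]
  have h : (y j + 2 * Real.pi * p j) / (2 * Real.pi) = y j / (2 * Real.pi) + p j := by
    have := Real.two_pi_pos.ne'
    field_simp
  simp only [PiLp.add_apply]
  rw [h, Int.floor_add_intCast]
  push_cast
  ring

theorem expMode_cellFract {d : ℕ} (n : Fin d → ℤ) (y : E d) :
    expMode n (cellFract y) = expMode n y := by
  unfold expMode
  rw [Complex.exp_eq_exp_iff_exists_int]
  refine ⟨-∑ j, n j * ⌊y j / (2 * Real.pi)⌋, ?_⟩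
  simp only [cellFract_apply]
  push_cast
  simp only [mul_sub, Finset.sum_sub_distrib, Finset.mul_sum, neg_mul, Finset.sum_mul]
  rw [sub_eq_add_neg]
  congr 2
  refine Finset.sum_congr rfl fun j _ => ?_
  ring

/-- The period subtracted by `cellFract` depends on the point. There are only countably many
periods, so the exceptional sets can be united. -/
theorem ae_cellFract_eq {d : ℕ} {u : E d → ℂ}
    (hu : ∀ p : Fin d → ℤ, ∀ᵐ y, u (y + WithLp.toLp 2 (fun j => 2 * Real.pi * (p j : ℝ))) = u y) :
    ∀ᵐ y, u (cellFract y) = u y := by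
  filter_upwards [ae_all_iff.mpr hu] with y hy
  exact hy fun j => -⌊y j / (2 * Real.pi)⌋

theorem measurableSet_cell (d : ℕ) : MeasurableSet (cell d) := by
  have : cell d = ⋂ i, (fun y : E d => y i) ⁻¹' Set.Ico 0 (2 * Real.pi) := by
    ext; simp [cell]
  rw [this]
  exact MeasurableSet.iInter fun i => (by fun_prop : Measurable fun y : E d => y i)
    measurableSet_Ico

/-- A ball meets only finitely many translates of the cell, and each contributes at most the volume
of `s` inside the cell. `N` counts a finite set of translates covering the ball. -/
theorem exists_volume_ball_inter_cellFract_le (d : ℕ) (r : ℝ) :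
    ∃ N : ℕ, ∀ s : Set (E d), MeasurableSet s →
      volume (Metric.ball 0 r ∩ cellFract ⁻¹' s) ≤ N * volume (cell d ∩ s) := by
  -- In the ball `|y j / 2π| ≤ |r|`, because `2π ≥ 1`. The extra `1` leaves room for the floor.
  set K : ℤ := ⌈|r|⌉ + 1 with hK
  set P : Finset (Fin d → ℤ) := Fintype.piFinset fun _ => Finset.Icc (-K) K with hP
  refine ⟨P.card, fun s hs => ?_⟩
  set t : (Fin d → ℤ) → E d → E d :=
    fun p y => y + WithLp.toLp 2 (fun j => 2 * Real.pi * ((-p j : ℤ) : ℝ)) with ht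
  have hsub : Metric.ball 0 r ∩ cellFract ⁻¹' s ⊆ ⋃ p ∈ P, t p ⁻¹' (cell d ∩ s) := by
    rintro y ⟨hy, hys⟩
    refine Set.mem_biUnion (x := fun j => ⌊y j / (2 * Real.pi)⌋) ?_ ⟨cellFract_mem y, hys⟩
    rw [Finset.mem_coe, hP, Fintype.mem_piFinset]
    intro j
    have h1 : |y j| < r := by
      have h2 := PiLp.norm_apply_le y j
      rw [Real.norm_eq_abs] at h2
      rw [mem_ball_zero_iff] at hy
      exact h2.trans_lt hy
    have h0 := Real.two_pi_pos
    have hpi : (1 : ℝ) ≤ 2 * Real.pi := by linarith [Real.pi_gt_three]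
    have h3 : |y j / (2 * Real.pi)| ≤ |r| := by
      rw [abs_div, abs_of_pos h0]
      exact (div_le_self (abs_nonneg _) hpi).trans (h1.le.trans (le_abs_self r))
    have h4 := abs_le.mp (h3.trans (Int.le_ceil |r|))
    rw [Finset.mem_Icc]
    constructor
    · rw [Int.le_floor, hK]
      push_cast
      linarith [h4.1]
    · refine Int.floor_le_iff.mpr ?_
      rw [hK]
      push_cast
      linarith [h4.2]
  refine (measure_mono hsub).trans ((measure_biUnion_finset_le P _).trans ?_)
  have : ∀ p ∈ P, volume (t p ⁻¹' (cell d ∩ s)) = volume (cell d ∩ s) := fun p _ =>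
    (measurePreserving_add_right volume _).measure_preimage
      ((measurableSet_cell d).inter hs).nullMeasurableSet
  rw [Finset.sum_congr rfl this]
  simp

open scoped Pointwise in
/-- The image of Lebesgue measure on a ball under `x ↦ x / ε` modulo `2πℤ^d`. -/
theorem exists_map_cellFract_le (d : ℕ) {ε : ℝ} (hε : 0 < ε) (R : ℝ) :
    ∃ C : ℝ≥0∞, C ≠ ⊤ ∧
      Measure.map (fun x : E d => cellFract (ε⁻¹ • x)) (volume.restrict (Metric.ball 0 R)) ≤
        C • cellMeasure d := by
  obtain ⟨N, hN⟩ := exists_volume_ball_inter_cellFract_le d (ε⁻¹ * R)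
  have hm : Measurable fun x : E d => cellFract (ε⁻¹ • x) :=
    (measurable_cellFract d).comp (by fun_prop)
  refine ⟨ENNReal.ofReal |(ε ^ Module.finrank ℝ (E d))| * N, by finiteness, ?_⟩
  refine Measure.le_iff.mpr fun s hs => ?_
  rw [Measure.map_apply hm hs, Measure.restrict_apply (hm hs), Measure.smul_apply,
    Measure.restrict_apply hs, smul_eq_mul, mul_assoc, Set.inter_comm s]
  have e : (fun x : E d => cellFract (ε⁻¹ • x)) ⁻¹' s ∩ Metric.ball 0 R =
      ε • (Metric.ball 0 (ε⁻¹ * R) ∩ cellFract ⁻¹' s) := by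
    ext x
    rw [Set.mem_smul_set_iff_inv_smul_mem₀ hε.ne']
    simp only [Set.mem_inter_iff, Set.mem_preimage, mem_ball_zero_iff, norm_smul]
    rw [and_comm, norm_inv, Real.norm_eq_abs, abs_of_pos hε,
      mul_lt_mul_iff_right₀ (inv_pos.mpr hε)]
  rw [e, Measure.addHaar_smul]
  gcongr
  exact hN s hs

/-- A constant comparing Lebesgue measure on a ball with Lebesgue measure on the cell. -/
def ballConst (d : ℕ) {ε : ℝ} (hε : 0 < ε) (R : ℝ) : ℝ≥0∞ := (exists_map_cellFract_le d hε R).choose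

theorem ballConst_ne_top (d : ℕ) {ε : ℝ} (hε : 0 < ε) (R : ℝ) : ballConst d hε R ≠ ⊤ :=
  (exists_map_cellFract_le d hε R).choose_spec.1

theorem map_cellFract_le (d : ℕ) {ε : ℝ} (hε : 0 < ε) (R : ℝ) :
    Measure.map (fun x : E d => cellFract (ε⁻¹ • x)) (volume.restrict (Metric.ball 0 R)) ≤
      ballConst d hε R • cellMeasure d :=
  (exists_map_cellFract_le d hε R).choose_spec.2

section Periodic

variable {d : ℕ} {ε : ℝ}

theorem measurable_cellFract_smul (d : ℕ) (ε : ℝ) :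
    Measurable fun x : E d => cellFract (ε⁻¹ • x) :=
  (measurable_cellFract d).comp (by fun_prop)

theorem quasiMeasurePreserving_cellFract (hε : 0 < ε) (R : ℝ) :
    Measure.QuasiMeasurePreserving (fun x : E d => cellFract (ε⁻¹ • x))
      (volume.restrict (Metric.ball 0 R)) (cellMeasure d) :=
  ⟨measurable_cellFract_smul d ε, (Measure.absolutelyContinuous_of_le
    (map_cellFract_le d hε R)).trans Measure.smul_absolutelyContinuous⟩

theorem eLpNorm_comp_cellFract_le (hε : 0 < ε) (R : ℝ) {w : E d → ℂ}
    (hw : AEStronglyMeasurable w (cellMeasure d)) :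
    eLpNorm (fun x : E d => w (cellFract (ε⁻¹ • x))) 2 (volume.restrict (Metric.ball 0 R)) ≤
      ballConst d hε R ^ (1 / 2 : ℝ) * eLpNorm w 2 (cellMeasure d) := by
  have hm := (measurable_cellFract_smul d ε).aemeasurable
    (μ := volume.restrict (Metric.ball 0 R))
  have h1 : AEStronglyMeasurable w
      (Measure.map (fun x : E d => cellFract (ε⁻¹ • x)) (volume.restrict (Metric.ball 0 R))) :=
    hw.mono_ac (quasiMeasurePreserving_cellFract hε R).absolutelyContinuous
  have h2 := eLpNorm_map_measure (p := 2) h1 hm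
  change eLpNorm (w ∘ fun x : E d => cellFract (ε⁻¹ • x)) 2 _ ≤ _
  rw [← h2]
  refine (eLpNorm_mono_measure w (map_cellFract_le d hε R)).trans ?_
  rw [eLpNorm_smul_measure_of_ne_top ENNReal.ofNat_ne_top]
  simp

theorem memLp_comp_cellFract (hε : 0 < ε) (R : ℝ) {w : E d → ℂ}
    (hw : MemLp w 2 (cellMeasure d)) :
    MemLp (fun x : E d => w (cellFract (ε⁻¹ • x))) 2 (volume.restrict (Metric.ball 0 R)) :=
  ⟨hw.1.comp_quasiMeasurePreserving (quasiMeasurePreserving_cellFract hε R),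
    (eLpNorm_comp_cellFract_le hε R hw.1).trans_lt (ENNReal.mul_lt_top
      (ENNReal.rpow_lt_top_of_nonneg (by norm_num) (ballConst_ne_top d hε R)) hw.2)⟩

/-- Periodic extension, rescaling and restriction to a ball, as a continuous linear map. -/
def extendToBall (hε : 0 < ε) (R : ℝ) :
    Lp ℂ 2 (cellMeasure d) →L[ℂ] Lp ℂ 2 (volume.restrict (Metric.ball (0 : E d) R)) :=
  LinearMap.mkContinuous
    { toFun := fun w => (memLp_comp_cellFract hε R (Lp.memLp w)).toLp _
      map_add' := fun v w => by
        rw [← MemLp.toLp_add]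
        exact MemLp.toLp_congr _ _
          ((quasiMeasurePreserving_cellFract hε R).ae (Lp.coeFn_add v w))
      map_smul' := fun a w => by
        rw [RingHom.id_apply, ← MemLp.toLp_const_smul]
        exact MemLp.toLp_congr _ _
          ((quasiMeasurePreserving_cellFract hε R).ae (Lp.coeFn_smul a w)) }
    (ballConst d hε R ^ (1 / 2 : ℝ)).toReal
    (fun w => by
      change ‖(memLp_comp_cellFract hε R (Lp.memLp w)).toLp _‖ ≤ _
      rw [Lp.norm_toLp, Lp.norm_def, ← ENNReal.toReal_mul]
      exact ENNReal.toReal_mono (ENNReal.mul_ne_top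
        (ENNReal.rpow_ne_top_of_nonneg (by norm_num) (ballConst_ne_top d hε R)) (Lp.memLp w).2.ne)
        (eLpNorm_comp_cellFract_le hε R (Lp.memLp w).1))

theorem coeFn_extendToBall_toLp (hε : 0 < ε) (R : ℝ) {w : E d → ℂ}
    (hw : MemLp w 2 (cellMeasure d)) :
    extendToBall hε R (hw.toLp w) =ᵐ[volume.restrict (Metric.ball (0 : E d) R)]
      fun x => w (cellFract (ε⁻¹ • x)) := by
  refine (MemLp.coeFn_toLp (memLp_comp_cellFract hε R (Lp.memLp (hw.toLp w)))).trans ?_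
  exact (quasiMeasurePreserving_cellFract hε R).ae hw.coeFn_toLp

theorem MemH2Per.ae_cellFract_smul_eq {u : E d → ℂ} (hu : MemH2Per u) (hε : 0 < ε) :
    ∀ᵐ x : E d, u (cellFract (ε⁻¹ • x)) = u (ε⁻¹ • x) :=
  (quasiMeasurePreserving_smul (inv_ne_zero hε.ne')).ae (ae_cellFract_eq hu.periodic)

/-- The reason a Bloch coefficient at `ξ` sees the Fourier transform only at the points `ξ + n/ε`.
-/
theorem planeWave_mul_expMode (ε : ℝ) (n : Fin d → ℤ) (x ξ : E d) :
    planeWave x ξ * expMode n (ε⁻¹ • x) = planeWave x (ξ + latticePoint ε n) := by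
  unfold planeWave expMode
  rw [← Complex.exp_add, ← mul_add, ← Complex.ofReal_add, ← Finset.sum_add_distrib]
  refine congrArg (fun r : ℝ => Complex.exp (Complex.I * r))
    (Finset.sum_congr rfl fun j _ => ?_)
  simp [latticePoint]
  ring

theorem norm_planeWave (x ξ : E d) : ‖planeWave x ξ‖ = 1 := by
  unfold planeWave
  rw [mul_comm, Complex.norm_exp_ofReal_mul_I]

theorem continuous_planeWave : Continuous fun z : E d × E d => planeWave z.1 z.2 := by
  unfold planeWave
  fun_prop

theorem memLp_mul_conj_planeWave {R : ℝ} {h : E d → ℂ}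
    (hh : MemLp h 2 (volume.restrict (Metric.ball 0 R))) (ξ : E d) :
    MemLp (fun x => h x * conj (planeWave x ξ)) 2 (volume.restrict (Metric.ball 0 R)) := by
  have hc : Continuous fun x : E d => conj (planeWave x ξ) :=
    Complex.continuous_conj.comp (continuous_planeWave.comp (by fun_prop : Continuous
      fun x : E d => (x, ξ)))
  refine hh.of_le (hh.1.mul hc.aestronglyMeasurable) (Eventually.of_forall fun x => ?_)
  rw [norm_mul, RCLike.norm_conj, norm_planeWave, mul_one]

/-- The integral of a function on a ball against a periodic function and a plane wave, in terms of
the Fourier coefficients of the periodic function. -/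
theorem hasSum_integral_ball_mul_conj (hε : 0 < ε) {R : ℝ} {h : E d → ℂ}
    (hh : MemLp h 2 (volume.restrict (Metric.ball 0 R))) {ψ : E d → ℂ} (hψ : MemH2Per ψ)
    (ξ : E d) :
    HasSum (fun n => (∫ x in Metric.ball 0 R, h x * conj (planeWave x (ξ + latticePoint ε n))) *
        conj (fourierCoeffPer ψ n))
      (∫ x in Metric.ball 0 R, h x * conj (planeWave x ξ) * conj (ψ (ε⁻¹ • x))) := by
  have hg := memLp_mul_conj_planeWave hh ξ
  -- The Fourier series of `ψ` converges in `L²` of the cell. Extension to the ball and pairing with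
  -- `h` times a plane wave are continuous, so both may be applied term by term.
  have h1 := ((hasSum_fourierCoeffPer hψ.memLp).mapL (extendToBall hε R)).mapL
    (innerSL ℂ (hg.toLp _))
  have h2 := h1.mapL (Complex.conjCLE : ℂ →L[ℝ] ℂ)
  simp only [map_smul, innerSL_apply_apply, smul_eq_mul, ContinuousLinearEquiv.coe_coe,
    Complex.conjCLE_apply, map_mul, inner_conj_symm] at h2
  simp only [L2.inner_def] at h2
  convert! h2 using 1
  · ext n
    rw [mul_comm]
    congr 1
    refine integral_congr_ae ?_
    filter_upwards [hg.coeFn_toLp, coeFn_extendToBall_toLp hε R (memLp_expMode n)] with x h3 h4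
    change _ = inner ℂ (extendToBall hε R (MemLp.toLp (expMode n) (memLp_expMode n)) x) _
    rw [h3, h4, expMode_cellFract, RCLike.inner_apply, ← planeWave_mul_expMode ε, map_mul]
    ring
  · refine integral_congr_ae ?_
    filter_upwards [hg.coeFn_toLp, coeFn_extendToBall_toLp hε R hψ.memLp,
      ae_restrict_of_ae (hψ.ae_cellFract_smul_eq hε)] with x h3 h4 h5
    rw [h3, h4, h5, RCLike.inner_apply]

/-- The periodic extension of a function on the cell with rapidly decaying Fourier coefficients. -/
theorem memH2Per_comp_cellFract {w : E d → ℂ} (hw : MemLp w 2 (cellMeasure d))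
    (hs : Summable fun n : Fin d → ℤ =>
      (1 + ∑ j, (n j : ℝ) ^ 2) ^ 2 * ‖fourierCoeffPer w n‖ ^ 2) :
    MemH2Per fun y => w (cellFract y) := by
  have h : (fun y => w (cellFract y)) =ᵐ[cellMeasure d] w := by
    filter_upwards [ae_restrict_mem (measurableSet_cell d)] with y hy
    rw [cellFract_eq_of_mem hy]
  refine ⟨fun p => Eventually.of_forall fun y => ?_, (memLp_congr_ae h).mpr hw, ?_⟩
  · simp only [cellFract_add]
  · simpa only [fourierCoeffPer_congr h] using hs

end Periodic

/-! ### Fibres and Bloch coefficients -/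

theorem eLpNorm_two_sq {X F : Type*} [MeasurableSpace X] {μ : Measure X} [NormedAddCommGroup F]
    (f : X → F) : eLpNorm f 2 μ ^ 2 = ∫⁻ x, ‖f x‖ₑ ^ 2 ∂μ := by
  rw [eLpNorm_eq_lintegral_rpow_enorm_toReal two_ne_zero ENNReal.ofNat_ne_top,
    ← ENNReal.rpow_natCast, ← ENNReal.rpow_mul]
  simp

theorem enorm_sq_eq_ofReal {F : Type*} [SeminormedAddCommGroup F] (x : F) :
    ‖x‖ₑ ^ 2 = ENNReal.ofReal (‖x‖ ^ 2) := by
  rw [ENNReal.ofReal_pow (norm_nonneg x), ofReal_norm]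

theorem summable_norm_sq_of_tsum_enorm_ne_top {ι : Type*} {c : ι → ℂ}
    (h : ∑' n, ‖c n‖ₑ ^ 2 ≠ ⊤) : Summable fun n => ‖c n‖ ^ 2 := by
  have := ENNReal.summable_toReal h
  simpa using this

theorem enorm_fourierSeries_sq {d : ℕ} {c : (Fin d → ℤ) → ℂ}
    (hc : Summable fun n => ‖c n‖ ^ 2) :
    ‖fourierSeries c‖ₑ ^ 2 = ENNReal.ofReal (cellVol d) * ∑' n, ‖c n‖ₑ ^ 2 := by
  rw [enorm_sq_eq_ofReal, ← (norm_fourierSeries_sq hc).tsum_eq, tsum_mul_left,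
    ENNReal.ofReal_mul (cellVol_pos d).le, ENNReal.ofReal_tsum_of_nonneg (fun n => by positivity) hc]
  simp only [enorm_sq_eq_ofReal]

section Fiber

variable {d : ℕ} {ε : ℝ}

/-- The fibre at `ξ` of the Bloch decomposition of `u`: the periodic function with Fourier
coefficients `(2π)^{-d} û(ξ + n / ε)`. -/
def fiber (ε : ℝ) (u : L2 d) (ξ : E d) : Lp ℂ 2 (cellMeasure d) :=
  fourierSeries fun n => (cellVol d : ℂ)⁻¹ * angularFourier u (ξ + latticePoint ε n)

/-- The Bloch coefficient of `u` for the mode `φ`. -/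
def blochCoeff (ε : ℝ) (φ : E d → E d → ℂ) (u : L2 d) (ξ : E d) : ℂ :=
  ∫ y in cell d, fiber ε u ξ y * conj (φ y (ε • ξ))

theorem quasiMeasurePreserving_add_latticePoint (ε : ℝ) (n : Fin d → ℤ) :
    Measure.QuasiMeasurePreserving (fun ξ : E d => ξ + latticePoint ε n)
      (volume.restrict (scaledDualCell d ε)) volume :=
  (measurePreserving_add_right volume _).quasiMeasurePreserving.mono_left
    Measure.restrict_le_self.absolutelyContinuous

theorem aestronglyMeasurable_angularFourier_add (ε : ℝ) (u : L2 d) (n : Fin d → ℤ) :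
    AEStronglyMeasurable (fun ξ => angularFourier u (ξ + latticePoint ε n))
      (volume.restrict (scaledDualCell d ε)) :=
  (aestronglyMeasurable_angularFourier u).comp_quasiMeasurePreserving
    (quasiMeasurePreserving_add_latticePoint ε n)

/-- Plancherel's theorem on `ℝ^d`, folded into one dual cell by the tiling. -/
theorem lintegral_tsum_angularFourier (hε : 0 < ε) (u : L2 d) :
    ∫⁻ ξ in scaledDualCell d ε, ∑' n, ‖angularFourier u (ξ + latticePoint ε n)‖ₑ ^ 2 =
      ENNReal.ofReal (cellVol d * ‖u‖ ^ 2) := by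
  rw [lintegral_tsum fun n =>
    (aestronglyMeasurable_angularFourier_add ε u n).enorm.pow_const 2,
    ← lintegral_enorm_angularFourier_sq, lintegral_eq_tsum_dualCell hε]

theorem aemeasurable_tsum_angularFourier (ε : ℝ) (u : L2 d) :
    AEMeasurable (fun ξ => ∑' n, ‖angularFourier u (ξ + latticePoint ε n)‖ₑ ^ 2)
      (volume.restrict (scaledDualCell d ε)) :=
  AEMeasurable.tsum fun n =>
    (aestronglyMeasurable_angularFourier_add ε u n).enorm.pow_const 2

/-- A nonnegative function with finite integral is finite almost everywhere. At these `ξ` the series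
defining `fiber` converges. -/
theorem ae_summable_angularFourier (hε : 0 < ε) (u : L2 d) :
    ∀ᵐ ξ ∂(volume.restrict (scaledDualCell d ε)),
      Summable fun n => ‖angularFourier u (ξ + latticePoint ε n)‖ ^ 2 := by
  have h := ae_lt_top' (aemeasurable_tsum_angularFourier ε u)
    (by rw [lintegral_tsum_angularFourier hε]; exact ENNReal.ofReal_ne_top)
  filter_upwards [h] with ξ hξ
  exact summable_norm_sq_of_tsum_enorm_ne_top hξ.ne

theorem summable_const_mul_norm_sq {ι : Type*} (a : ℂ) {c : ι → ℂ}
    (hc : Summable fun n => ‖c n‖ ^ 2) : Summable fun n => ‖a * c n‖ ^ 2 := by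
  simpa only [norm_mul, mul_pow] using hc.mul_left (‖a‖ ^ 2)

theorem enorm_fiber_sq {u : L2 d} {ξ : E d}
    (h : Summable fun n => ‖angularFourier u (ξ + latticePoint ε n)‖ ^ 2) :
    ‖fiber ε u ξ‖ₑ ^ 2 = ENNReal.ofReal (cellVol d)⁻¹ *
      ∑' n, ‖angularFourier u (ξ + latticePoint ε n)‖ₑ ^ 2 := by
  have hv := cellVol_pos d
  rw [fiber, enorm_fourierSeries_sq (summable_const_mul_norm_sq _ h)]
  simp only [enorm_mul, mul_pow]
  rw [ENNReal.tsum_mul_left, ← mul_assoc]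
  congr 1
  rw [enorm_sq_eq_ofReal, ← ENNReal.ofReal_mul hv.le, norm_inv, Complex.norm_real,
    Real.norm_eq_abs, abs_of_pos hv]
  congr 1
  field_simp

/-- Measurability is read off the Parseval formula for the norm, so none is needed for the
`L²`-valued map `ξ ↦ fiber ε u ξ`. -/
theorem aemeasurable_enorm_fiber_sq (hε : 0 < ε) (u : L2 d) :
    AEMeasurable (fun ξ => ‖fiber ε u ξ‖ₑ ^ 2) (volume.restrict (scaledDualCell d ε)) := by
  refine ((aemeasurable_tsum_angularFourier ε u).const_mul
    (ENNReal.ofReal (cellVol d)⁻¹)).congr ?_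
  filter_upwards [ae_summable_angularFourier hε u] with ξ hξ
  exact (enorm_fiber_sq hξ).symm

/-- The Bloch decomposition is isometric. -/
theorem lintegral_enorm_fiber_sq (hε : 0 < ε) (u : L2 d) :
    ∫⁻ ξ in scaledDualCell d ε, ‖fiber ε u ξ‖ₑ ^ 2 = ENNReal.ofReal (‖u‖ ^ 2) := by
  have hv := cellVol_pos d
  have h : ∫⁻ ξ in scaledDualCell d ε, ‖fiber ε u ξ‖ₑ ^ 2 =
      ∫⁻ ξ in scaledDualCell d ε, ENNReal.ofReal (cellVol d)⁻¹ *
        ∑' n, ‖angularFourier u (ξ + latticePoint ε n)‖ₑ ^ 2 := by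
    refine lintegral_congr_ae ?_
    filter_upwards [ae_summable_angularFourier hε u] with ξ hξ
    exact enorm_fiber_sq hξ
  rw [h, lintegral_const_mul' _ _ ENNReal.ofReal_ne_top, lintegral_tsum_angularFourier hε,
    ← ENNReal.ofReal_mul (inv_pos.mpr hv).le, inv_mul_cancel_left₀ hv.ne']

/-- Parseval on the cell, whose factor `cellVol d` cancels the inverse in `fiber`. This scalar
series gives the additivity and measurability of the coefficient in `ξ`. -/
theorem hasSum_blochCoeff {φ : E d → E d → ℂ} {u : L2 d} {ξ : E d}
    (h : Summable fun n => ‖angularFourier u (ξ + latticePoint ε n)‖ ^ 2)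
    (hφ : MemLp (fun y => φ y (ε • ξ)) 2 (cellMeasure d)) :
    HasSum (fun n => angularFourier u (ξ + latticePoint ε n) *
      conj (fourierCoeffPer (fun y => φ y (ε • ξ)) n)) (blochCoeff ε φ u ξ) := by
  refine (hasSum_fourierCoeffPer_mul_conj (Lp.memLp (fiber ε u ξ)) hφ).congr_fun fun n => ?_
  rw [fiber, fourierCoeffPer_fourierSeries (summable_const_mul_norm_sq _ h)]
  field_simp [cellVol_ne_zero d]

theorem ae_angularFourier_toLp_add (ε : ℝ) {h : E d → ℂ} (h1 : Integrable h) (h2 : MemLp h 2) :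
    ∀ᵐ ξ ∂(volume.restrict (scaledDualCell d ε)), ∀ n : Fin d → ℤ,
      angularFourier (h2.toLp h) (ξ + latticePoint ε n) =
        ∫ x, h x * conj (planeWave x (ξ + latticePoint ε n)) := by
  rw [ae_all_iff]
  exact fun n => (quasiMeasurePreserving_add_latticePoint ε n).ae (angularFourier_toLp_ae_eq h1 h2)

theorem ae_angularFourier_sub_add (ε : ℝ) (u v : L2 d) :
    ∀ᵐ ξ ∂(volume.restrict (scaledDualCell d ε)), ∀ n : Fin d → ℤ,
      angularFourier (u - v) (ξ + latticePoint ε n) =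
        angularFourier u (ξ + latticePoint ε n) - angularFourier v (ξ + latticePoint ε n) := by
  rw [ae_all_iff]
  exact fun n => (quasiMeasurePreserving_add_latticePoint ε n).ae (angularFourier_sub u v)

theorem ae_mem_scaledDualCell (d : ℕ) (ε : ℝ) :
    ∀ᵐ ξ ∂((volume : Measure (E d)).restrict (scaledDualCell d ε)), ε • ξ ∈ dualCell d :=
  ae_restrict_mem (measurableSet_scaledDualCell d ε)

theorem blochCoeff_sub (hε : 0 < ε) {φ : E d → E d → ℂ}
    (hφ : ∀ η ∈ dualCell d, MemLp (fun y => φ y η) 2 (cellMeasure d)) (u v : L2 d) :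
    ∀ᵐ ξ ∂(volume.restrict (scaledDualCell d ε)),
      blochCoeff ε φ (u - v) ξ = blochCoeff ε φ u ξ - blochCoeff ε φ v ξ := by
  filter_upwards [ae_summable_angularFourier hε u, ae_summable_angularFourier hε v,
    ae_summable_angularFourier hε (u - v), ae_angularFourier_sub_add ε u v,
    ae_mem_scaledDualCell d ε] with ξ h1 h2 h3 h4 h5
  refine (hasSum_blochCoeff h3 (hφ _ h5)).unique ?_
  refine ((hasSum_blochCoeff h1 (hφ _ h5)).sub (hasSum_blochCoeff h2 (hφ _ h5))).congr_fun
    fun n => ?_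
  rw [h4, sub_mul]

/-! ### Truncation to balls. -/

theorem memLp_indicator_ball (u : L2 d) (R : ℝ) :
    MemLp ((Metric.ball (0 : E d) R).indicator u) 2 volume :=
  (Lp.memLp u).indicator measurableSet_ball

/-- The restriction of `u ∈ L²(ℝ^d)` to a ball, extended by zero. -/
def truncate (u : L2 d) (R : ℝ) : L2 d := (memLp_indicator_ball u R).toLp _

theorem integrable_indicator_ball (u : L2 d) (R : ℝ) :
    Integrable ((Metric.ball (0 : E d) R).indicator u) := by
  rw [integrable_indicator_iff measurableSet_ball]
  have : IsFiniteMeasure ((volume : Measure (E d)).restrict (Metric.ball 0 R)) :=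
    ⟨by simpa using measure_ball_lt_top⟩
  exact ((Lp.memLp u).restrict _).integrable one_le_two

/-- The Bloch coefficient of a truncated function is given by an integral. -/
theorem integral_ball_eq_blochCoeff (hε : 0 < ε) {φ : E d → E d → ℂ}
    (hφ : ∀ η ∈ dualCell d, MemH2Per (fun y => φ y η)) (u : L2 d) (R : ℝ) :
    ∀ᵐ ξ ∂(volume.restrict (scaledDualCell d ε)),
      ∫ x in Metric.ball 0 R, u x * conj (planeWave x ξ) * conj (scaledMode ε φ x ξ) =
        blochCoeff ε φ (truncate u R) ξ := by
  filter_upwards [ae_summable_angularFourier hε (truncate u R), ae_mem_scaledDualCell d ε,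
    ae_angularFourier_toLp_add ε (integrable_indicator_ball u R) (memLp_indicator_ball u R)]
    with ξ h1 h2 h3
  refine (hasSum_integral_ball_mul_conj hε ((Lp.memLp u).restrict _) (hφ _ h2) ξ).unique ?_
  refine (hasSum_blochCoeff h1 (hφ _ h2).memLp).congr_fun fun n => ?_
  rw [truncate, h3 n, ← integral_indicator measurableSet_ball]
  congr 2
  ext x
  by_cases hx : x ∈ Metric.ball (0 : E d) R <;> simp [hx]

/-- The squared error is the integral of `‖u‖²` outside the ball, which vanishes in the limit by
dominated convergence. -/
theorem tendsto_truncate (u : L2 d) : Tendsto (fun R => ‖truncate u R - u‖ₑ) atTop (𝓝 0) := by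
  have h : ∀ R, ‖truncate u R - u‖ₑ ^ 2 =
      ∫⁻ x, (Metric.ball (0 : E d) R)ᶜ.indicator (fun x => ‖u x‖ₑ ^ 2) x := by
    intro R
    rw [enorm_sq_eq_ofReal, ← lintegral_enorm_sq_Lp]
    refine lintegral_congr_ae ?_
    filter_upwards [Lp.coeFn_sub (truncate u R) u, (memLp_indicator_ball u R).coeFn_toLp]
      with x h1 h2
    rw [h1, Pi.sub_apply, truncate, h2]
    by_cases hx : x ∈ Metric.ball (0 : E d) R <;> simp [hx]
  have h2 : Tendsto (fun R => ‖truncate u R - u‖ₑ ^ 2) atTop (𝓝 0) := by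
    simp only [h]
    have h3 := tendsto_lintegral_filter_of_dominated_convergence (μ := (volume : Measure (E d)))
      (l := (atTop : Filter ℝ))
      (F := fun R x => (Metric.ball (0 : E d) R)ᶜ.indicator (fun x => ‖u x‖ₑ ^ 2) x)
      (f := fun _ => 0) (fun x => ‖u x‖ₑ ^ 2)
      (Eventually.of_forall fun R => by
        refine Measurable.indicator ?_ measurableSet_ball.compl
        have := (Lp.stronglyMeasurable u).measurable
        fun_prop)
      (Eventually.of_forall fun R => Eventually.of_forall fun x => Set.indicator_le_self _ _ x)
      (by rw [lintegral_enorm_sq_Lp]; exact ENNReal.ofReal_ne_top)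
      (Eventually.of_forall fun x => by
        refine tendsto_const_nhds.congr' ?_
        filter_upwards [eventually_gt_atTop ‖x‖] with R hR
        have : x ∈ Metric.ball (0 : E d) R := by simpa using hR
        simp [this])
    simpa using h3
  have h4 := (ENNReal.continuous_rpow_const (y := (1 / 2 : ℝ))).tendsto 0 |>.comp h2
  convert! h4 using 1
  · ext R
    rw [Function.comp_apply, ← ENNReal.rpow_natCast, ← ENNReal.rpow_mul]
    simp
  · simp

/-! ### Measurability -/

theorem quasiMeasurePreserving_smul_scaledDualCell (hε : 0 < ε) :
    Measure.QuasiMeasurePreserving (fun ξ : E d => ε • ξ)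
      (volume.restrict (scaledDualCell d ε)) (volume.restrict (dualCell d)) :=
  (quasiMeasurePreserving_smul hε.ne').restrict fun _ h => h

variable {A : E d → Matrix (Fin d) (Fin d) ℝ} {ρ : ℝ} {lam : ℕ → E d → ℝ}
  {φ : ℕ → E d → E d → ℂ}

theorem IsBlochSystem.aestronglyMeasurable_smul (hB : IsBlochSystem A ρ lam φ) (hε : 0 < ε)
    (m : ℕ) : AEStronglyMeasurable (fun z : E d × E d => φ m z.1 (ε • z.2))
      ((cellMeasure d).prod (volume.restrict (scaledDualCell d ε))) := by
  have h : Measure.QuasiMeasurePreserving (fun z : E d × E d => (z.1, ε • z.2))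
      ((cellMeasure d).prod (volume.restrict (scaledDualCell d ε)))
      (volume.prod (volume.restrict (dualCell d))) :=
    QuasiMeasurePreserving.prodMap
      (⟨measurable_id, by simpa using Measure.restrict_le_self.absolutelyContinuous⟩)
      (quasiMeasurePreserving_smul_scaledDualCell hε)
  exact (hB.measurable m).comp_quasiMeasurePreserving h

theorem IsBlochSystem.aestronglyMeasurable_scaledMode (hB : IsBlochSystem A ρ lam φ) (hε : 0 < ε)
    (m : ℕ) : AEStronglyMeasurable (fun z : E d × E d => scaledMode ε (φ m) z.1 z.2)
      (volume.prod (volume.restrict (scaledDualCell d ε))) := by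
  have h : Measure.QuasiMeasurePreserving (fun z : E d × E d => (ε⁻¹ • z.1, ε • z.2))
      (volume.prod (volume.restrict (scaledDualCell d ε)))
      (volume.prod (volume.restrict (dualCell d))) :=
    QuasiMeasurePreserving.prodMap
      (quasiMeasurePreserving_smul (inv_ne_zero hε.ne'))
      (quasiMeasurePreserving_smul_scaledDualCell hε)
  exact (hB.measurable m).comp_quasiMeasurePreserving h

theorem IsBlochSystem.aestronglyMeasurable_fourierCoeffPer (hB : IsBlochSystem A ρ lam φ)
    (hε : 0 < ε) (m : ℕ) (n : Fin d → ℤ) :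
    AEStronglyMeasurable (fun ξ => fourierCoeffPer (fun y => φ m y (ε • ξ)) n)
      (volume.restrict (scaledDualCell d ε)) := by
  have h1 : AEStronglyMeasurable (fun z : E d × E d => φ m z.1 (ε • z.2) * conj (expMode n z.1))
      ((cellMeasure d).prod (volume.restrict (scaledDualCell d ε))) :=
    (hB.aestronglyMeasurable_smul hε m).mul (Complex.continuous_conj.comp
      ((continuous_expMode n).comp continuous_fst)).aestronglyMeasurable
  exact h1.prod_swap.integral_prod_right'.const_mul _

/-- The coefficient is an almost-everywhere limit of finite sums of measurable functions of `ξ`.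
Joint measurability of the fibre in `(y, ξ)` is thus avoided. -/
theorem IsBlochSystem.aestronglyMeasurable_blochCoeff (hB : IsBlochSystem A ρ lam φ)
    (hε : 0 < ε) (m : ℕ) (u : L2 d) :
    AEStronglyMeasurable (blochCoeff ε (φ m) u) (volume.restrict (scaledDualCell d ε)) := by
  refine aestronglyMeasurable_of_tendsto_ae (u := (atTop : Filter (Finset (Fin d → ℤ))))
    (f := fun s ξ => ∑ n ∈ s, angularFourier u (ξ + latticePoint ε n) *
      conj (fourierCoeffPer (fun y => φ m y (ε • ξ)) n)) (fun s => ?_) ?_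
  · refine Finset.aestronglyMeasurable_fun_sum s fun n _ => ?_
    exact (aestronglyMeasurable_angularFourier_add ε u n).mul
      (Complex.continuous_conj.comp_aestronglyMeasurable
        (hB.aestronglyMeasurable_fourierCoeffPer hε m n))
  · filter_upwards [ae_summable_angularFourier hε u, ae_mem_scaledDualCell d ε] with ξ h1 h2
    exact hasSum_blochCoeff h1 (hB.memH2 _ h2 m).memLp

/-! ### Bessel's inequality and existence of the Bloch coefficients -/

theorem IsBlochSystem.blochCoeff_eq_inner (hB : IsBlochSystem A ρ lam φ) {ξ : E d}
    (hξ : ε • ξ ∈ dualCell d) (m : ℕ) (u : L2 d) :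
    blochCoeff ε (φ m) u ξ = inner ℂ (h2PerToLp d (hB.mode hξ m)) (fiber ε u ξ) := by
  conv_rhs => rw [← Lp.toLp_coeFn (fiber ε u ξ) (Lp.memLp _)]
  exact (inner_toLp (hB.mode hξ m).2.memLp (Lp.memLp (fiber ε u ξ))).symm

theorem IsBlochSystem.sum_enorm_blochCoeff_sq_le (hB : IsBlochSystem A ρ lam φ) {ξ : E d}
    (hξ : ε • ξ ∈ dualCell d) (s : Finset ℕ) (u : L2 d) :
    ∑ m ∈ s, ‖blochCoeff ε (φ m) u ξ‖ₑ ^ 2 ≤ ‖fiber ε u ξ‖ₑ ^ 2 := by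
  simp only [enorm_sq_eq_ofReal]
  rw [← ENNReal.ofReal_sum_of_nonneg fun _ _ => by positivity]
  refine ENNReal.ofReal_le_ofReal ?_
  simp only [hB.blochCoeff_eq_inner hξ]
  exact (hB.orthonormal_mode hξ).sum_inner_products_le _

/-- Bessel's inequality for the Bloch coefficients. -/
theorem IsBlochSystem.sum_lintegral_blochCoeff_sq_le (hB : IsBlochSystem A ρ lam φ)
    (hε : 0 < ε) (s : Finset ℕ) (u : L2 d) :
    ∑ m ∈ s, ∫⁻ ξ in scaledDualCell d ε, ‖blochCoeff ε (φ m) u ξ‖ₑ ^ 2 ≤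
      ENNReal.ofReal (‖u‖ ^ 2) := by
  rw [← lintegral_finsetSum' _ fun m _ =>
    (hB.aestronglyMeasurable_blochCoeff hε m u).enorm.pow_const 2, ← lintegral_enorm_fiber_sq hε]
  refine lintegral_mono_ae ?_
  filter_upwards [ae_mem_scaledDualCell d ε] with ξ hξ
  exact hB.sum_enorm_blochCoeff_sq_le hξ s u

theorem IsBlochSystem.eLpNorm_blochCoeff_le (hB : IsBlochSystem A ρ lam φ) (hε : 0 < ε) (m : ℕ)
    (u : L2 d) :
    eLpNorm (blochCoeff ε (φ m) u) 2 (volume.restrict (scaledDualCell d ε)) ≤ ‖u‖ₑ := by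
  have h := hB.sum_lintegral_blochCoeff_sq_le hε {m} u
  rw [Finset.sum_singleton, ← eLpNorm_two_sq, ← enorm_sq_eq_ofReal] at h
  exact (ENNReal.pow_le_pow_left_iff two_ne_zero).mp h

/-- The integral over a ball is the coefficient of the truncated function. Since the coefficient map
is subtractive and contracts `L²` norms, convergence of the truncations carries over. -/
theorem IsBlochSystem.isBlochCoeff (hB : IsBlochSystem A ρ lam φ) (hε : 0 < ε) (m : ℕ)
    (u : L2 d) : IsBlochCoeff ε (φ m) u (blochCoeff ε (φ m) u) := by
  refine ⟨⟨hB.aestronglyMeasurable_blochCoeff hε m u,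
    (hB.eLpNorm_blochCoeff_le hε m u).trans_lt enorm_lt_top⟩, ?_⟩
  refine tendsto_of_tendsto_of_tendsto_of_le_of_le tendsto_const_nhds (tendsto_truncate u)
    (fun R => zero_le) fun R => ?_
  refine le_trans (le_of_eq ?_) (hB.eLpNorm_blochCoeff_le hε m (truncate u R - u))
  refine eLpNorm_congr_ae ?_
  filter_upwards [blochCoeff_sub hε (fun η hη => (hB.memH2 η hη m).memLp) (truncate u R) u,
    integral_ball_eq_blochCoeff hε (fun η hη => hB.memH2 η hη m) u R] with ξ h1 h2
  rw [h1, h2]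

end Fiber

/-! ### Energy bound for the higher modes -/

section Energy

variable {d : ℕ} {α β ε κ : ℝ} {A : E d → Matrix (Fin d) (Fin d) ℝ} {lam : ℕ → E d → ℝ}
  {φ : ℕ → E d → E d → ℂ} {u L : L2 d} {G : Fin d → L2 d}

theorem one_add_sum_sq_le (hε : 0 < ε) (ξ : E d) (n : Fin d → ℤ) :
    1 + ∑ j, (n j : ℝ) ^ 2 ≤ (1 + 2 * ∑ j, (ε * ξ j) ^ 2) +
      2 * ε ^ 2 * ∑ j, (ξ + latticePoint ε n) j ^ 2 := by
  rw [add_assoc]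
  gcongr
  rw [Finset.mul_sum, Finset.mul_sum, ← Finset.sum_add_distrib]
  refine Finset.sum_le_sum fun j _ => ?_
  have h : (n j : ℝ) = ε * (ξ + latticePoint ε n) j - ε * ξ j := by
    simp [latticePoint]
    field_simp
    ring
  rw [h]
  nlinarith [sq_nonneg (ε * (ξ + latticePoint ε n) j + ε * ξ j)]

/-- Since `n = ε(ξ + n/ε) - εξ`, the `H²` weight is controlled by `|ξ + n/ε|⁴` and a constant. These
correspond to the transforms of `Δu` and `u`. -/
theorem summable_h2 (hε : 0 < ε) {ξ : E d}
    (hu : Summable fun n => ‖angularFourier u (ξ + latticePoint ε n)‖ ^ 2)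
    (hL : Summable fun n => ‖angularFourier L (ξ + latticePoint ε n)‖ ^ 2)
    (h : ∀ n : Fin d → ℤ, angularFourier L (ξ + latticePoint ε n) =
      -((∑ j, (ξ + latticePoint ε n) j ^ 2 : ℝ) : ℂ) * angularFourier u (ξ + latticePoint ε n)) :
    Summable fun n : Fin d → ℤ =>
      (1 + ∑ j, (n j : ℝ) ^ 2) ^ 2 * ‖angularFourier u (ξ + latticePoint ε n)‖ ^ 2 := by
  set a := 1 + 2 * ∑ j, (ε * ξ j) ^ 2 with ha
  refine Summable.of_nonneg_of_le (fun n => by positivity) (fun n => ?_)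
    ((hu.mul_left (2 * a ^ 2)).add (hL.mul_left (2 * (2 * ε ^ 2) ^ 2)))
  have h1 := one_add_sum_sq_le hε ξ n
  rw [← ha] at h1
  have h2 : 0 ≤ ∑ j, (ξ + latticePoint ε n) j ^ 2 := by positivity
  have h0 : 0 ≤ 1 + ∑ j, (n j : ℝ) ^ 2 := by positivity
  rw [h n, norm_mul, norm_neg, Complex.norm_real, Real.norm_eq_abs, abs_of_nonneg h2,
    mul_pow (∑ j, (ξ + latticePoint ε n) j ^ 2), ← mul_assoc, ← add_mul]
  refine mul_le_mul_of_nonneg_right ?_ (by positivity)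
  have h3 := pow_le_pow_left₀ h0 h1 2
  refine h3.trans ?_
  nlinarith [sq_nonneg (a - 2 * ε ^ 2 * ∑ j, (ξ + latticePoint ε n) j ^ 2)]

/-- The source of the factor `ε²`. Because `n + εξ = ε(ξ + n/ε)`, each shifted derivative of the
fibre costs one `ε`. In the fourth-order term `(κ/ε)² ε⁴ = κ² ε²`, so it scales exactly like the
gradient term. -/
theorem IsBlochSystem.sum_norm_blochCoeff_sq_le (hA : IsAdmissible α β A) (hε : 0 < ε)
    (hB : IsBlochSystem A (κ / ε) lam φ) {ξ : E d} (hξ : ε • ξ ∈ dualCell d)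
    (hu : Summable fun n => ‖angularFourier u (ξ + latticePoint ε n)‖ ^ 2)
    (hG : ∀ j, Summable fun n => ‖angularFourier (G j) (ξ + latticePoint ε n)‖ ^ 2)
    (hL : Summable fun n => ‖angularFourier L (ξ + latticePoint ε n)‖ ^ 2)
    (eG : ∀ j, ∀ n : Fin d → ℤ, angularFourier (G j) (ξ + latticePoint ε n) =
      Complex.I * ((ξ + latticePoint ε n) j : ℂ) * angularFourier u (ξ + latticePoint ε n))
    (eL : ∀ n : Fin d → ℤ, angularFourier L (ξ + latticePoint ε n) =
      -((∑ j, (ξ + latticePoint ε n) j ^ 2 : ℝ) : ℂ) * angularFourier u (ξ + latticePoint ε n))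
    (N : ℕ) :
    ∑ m ∈ Finset.Icc 1 N, ‖blochCoeff ε (φ m) u ξ‖ ^ 2 ≤
      4 / α * ε ^ 2 * (|β| * d * ∑ j, ‖fiber ε (G j) ξ‖ ^ 2 + κ ^ 2 * ‖fiber ε L ξ‖ ^ 2) := by
  have hc : ∀ n, fourierCoeffPer (fiber ε u ξ) n =
      (cellVol d : ℂ)⁻¹ * angularFourier u (ξ + latticePoint ε n) := fun n =>
    fourierCoeffPer_fourierSeries (summable_const_mul_norm_sq _ hu) n
  -- The fibre is a class on the cell, whereas the form acts on periodic functions on the whole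
  -- space.
  set w : E d → ℂ := fun y => fiber ε u ξ (cellFract y) with hw
  have hae : w =ᵐ[cellMeasure d] fiber ε u ξ := by
    filter_upwards [ae_restrict_mem (measurableSet_cell d)] with y hy
    rw [hw]
    simp only [cellFract_eq_of_mem hy]
  have hmem : MemH2Per w := by
    refine memH2Per_comp_cellFract (Lp.memLp _) ?_
    refine ((summable_h2 hε hu hL eL).mul_left (‖(cellVol d : ℂ)⁻¹‖ ^ 2)).congr fun n => ?_
    rw [hc, norm_mul]
    ring
  have hcw : ∀ n, fourierCoeffPer w n =
      (cellVol d : ℂ)⁻¹ * angularFourier u (ξ + latticePoint ε n) := fun n => by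
    rw [fourierCoeffPer_congr hae, hc]
  have hscale : ∀ (n : Fin d → ℤ) (j : Fin d),
      (n j : ℝ) + (ε • ξ) j = ε * (ξ + latticePoint ε n) j := by
    intro n j
    simp [latticePoint]
    field_simp
    ring
  have hpart : ∀ j, shiftedPartial (ε • ξ) j w = (ε : ℂ) • fiber ε (G j) ξ := by
    intro j
    unfold shiftedPartial fiber
    rw [← fourierSeries_smul _ (summable_const_mul_norm_sq _ (hG j))]
    congr 1
    ext n
    rw [hcw, hscale, eG]
    push_cast
    ring
  have hlap : shiftedLaplacian (ε • ξ) w = ((ε ^ 2 : ℝ) : ℂ) • fiber ε L ξ := by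
    unfold shiftedLaplacian fiber
    rw [← fourierSeries_smul _ (summable_const_mul_norm_sq _ hL)]
    congr 1
    ext n
    simp only [hcw, hscale, eL, mul_pow, ← Finset.mul_sum]
    push_cast
    ring
  have hLp : h2PerToLp d ⟨w, hmem⟩ = fiber ε u ξ := by
    change hmem.memLp.toLp w = _
    conv_rhs => rw [← Lp.toLp_coeFn (fiber ε u ξ) (Lp.memLp _)]
    exact MemLp.toLp_congr _ _ hae
  have key := hB.sum_norm_inner_sq_le hA hξ ⟨w, hmem⟩ N
  simp only [hLp, ← hB.blochCoeff_eq_inner hξ, hpart, hlap, norm_smul, Complex.norm_real,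
    Real.norm_eq_abs, mul_pow, sq_abs, ← Finset.mul_sum] at key
  refine key.trans (le_of_eq ?_)
  field_simp

/-- Energy bound for the contribution of the higher modes. -/
theorem IsBlochSystem.sum_lintegral_blochCoeff_Icc_le (hA : IsAdmissible α β A) (hε : 0 < ε)
    (hB : IsBlochSystem A (κ / ε) lam φ) (hG : ∀ j, IsPartial j u (G j)) (hL : IsLaplacian u L)
    (N : ℕ) :
    ∑ m ∈ Finset.Icc 1 N, ∫⁻ ξ in scaledDualCell d ε, ‖blochCoeff ε (φ m) u ξ‖ₑ ^ 2 ≤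
      ENNReal.ofReal (4 / α * ε ^ 2 * (|β| * d * ∑ j, ‖G j‖ ^ 2 + κ ^ 2 * ‖L‖ ^ 2)) := by
  have hα := hA.pos
  -- Splits the bound into a sum of nonnegative terms, so that the integral over `ξ` passes to each
  -- fibre norm separately.
  have expand : ∀ (a : Fin d → ℝ) (b : ℝ),
      ENNReal.ofReal (4 / α * ε ^ 2 * (|β| * d * ∑ j, a j ^ 2 + κ ^ 2 * b ^ 2)) =
        ENNReal.ofReal (4 / α * ε ^ 2 * (|β| * d)) * ∑ j, ENNReal.ofReal (a j ^ 2) +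
          ENNReal.ofReal (4 / α * ε ^ 2 * κ ^ 2) * ENNReal.ofReal (b ^ 2) := by
    intro a b
    rw [← ENNReal.ofReal_sum_of_nonneg fun _ _ => by positivity, ← ENNReal.ofReal_mul
      (by positivity), ← ENNReal.ofReal_mul (by positivity), ← ENNReal.ofReal_add
      (by positivity) (by positivity)]
    congr 1
    ring
  rw [← lintegral_finsetSum' _ fun m _ =>
    (hB.aestronglyMeasurable_blochCoeff hε m u).enorm.pow_const 2, expand]
  have hGm : ∀ j ∈ Finset.univ, AEMeasurable (fun ξ => ‖fiber ε (G j) ξ‖ₑ ^ 2)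
      (volume.restrict (scaledDualCell d ε)) := fun j _ => aemeasurable_enorm_fiber_sq hε (G j)
  have hLm := aemeasurable_enorm_fiber_sq hε L
  calc ∫⁻ ξ in scaledDualCell d ε, ∑ m ∈ Finset.Icc 1 N, ‖blochCoeff ε (φ m) u ξ‖ₑ ^ 2
      ≤ ∫⁻ ξ in scaledDualCell d ε,
          (ENNReal.ofReal (4 / α * ε ^ 2 * (|β| * d)) * ∑ j, ‖fiber ε (G j) ξ‖ₑ ^ 2 +
          ENNReal.ofReal (4 / α * ε ^ 2 * κ ^ 2) * ‖fiber ε L ξ‖ₑ ^ 2) := by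
        refine lintegral_mono_ae ?_
        have e1 : ∀ᵐ ξ ∂(volume.restrict (scaledDualCell d ε)), ∀ j, Summable fun n =>
            ‖angularFourier (G j) (ξ + latticePoint ε n)‖ ^ 2 :=
          ae_all_iff.mpr fun j => ae_summable_angularFourier hε (G j)
        have e2 : ∀ᵐ ξ ∂(volume.restrict (scaledDualCell d ε)), ∀ j, ∀ n : Fin d → ℤ,
            angularFourier (G j) (ξ + latticePoint ε n) = Complex.I *
              ((ξ + latticePoint ε n) j : ℂ) * angularFourier u (ξ + latticePoint ε n) :=
          ae_all_iff.mpr fun j => ae_all_iff.mpr fun n =>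
            (quasiMeasurePreserving_add_latticePoint ε n).ae (hG j).angularFourier_ae_eq
        have e3 : ∀ᵐ ξ ∂(volume.restrict (scaledDualCell d ε)), ∀ n : Fin d → ℤ,
            angularFourier L (ξ + latticePoint ε n) =
              -((∑ j, (ξ + latticePoint ε n) j ^ 2 : ℝ) : ℂ) *
                angularFourier u (ξ + latticePoint ε n) :=
          ae_all_iff.mpr fun n =>
            (quasiMeasurePreserving_add_latticePoint ε n).ae hL.angularFourier_ae_eq
        filter_upwards [ae_mem_scaledDualCell d ε, ae_summable_angularFourier hε u, e1,
          ae_summable_angularFourier hε L, e2, e3] with ξ h0 h1 h2 h3 h4 h5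
        simp only [enorm_sq_eq_ofReal]
        rw [← expand, ← ENNReal.ofReal_sum_of_nonneg fun _ _ => by positivity]
        exact ENNReal.ofReal_le_ofReal
          (hB.sum_norm_blochCoeff_sq_le hA hε h0 h1 h2 h3 h4 h5 N)
    _ = _ := by
        rw [lintegral_add_right' _ (hLm.const_mul _),
          lintegral_const_mul' _ _ ENNReal.ofReal_ne_top,
          lintegral_const_mul' _ _ ENNReal.ofReal_ne_top, lintegral_finsetSum' _ hGm]
        simp only [lintegral_enorm_fiber_sq hε]

end Energy

/-! ### Synthesis -/

section Synthesis

variable {d : ℕ} {ε ρ : ℝ} {A : E d → Matrix (Fin d) (Fin d) ℝ} {lam : ℕ → E d → ℝ}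
  {φ : ℕ → E d → E d → ℂ}

theorem volume_scaledDualCell_lt_top (d : ℕ) (hε : 0 < ε) :
    volume (scaledDualCell d ε) < ⊤ := by
  refine (measure_mono (t := Metric.closedBall (0 : E d)
    (Real.sqrt (∑ _j : Fin d, (ε⁻¹) ^ 2))) ?_).trans_lt measure_closedBall_lt_top
  intro ξ hξ
  rw [mem_closedBall_zero_iff, EuclideanSpace.norm_eq]
  refine Real.sqrt_le_sqrt (Finset.sum_le_sum fun j _ => ?_)
  have h := hξ j
  simp only [PiLp.smul_apply, smul_eq_mul, Set.mem_Ico] at h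
  rw [Real.norm_eq_abs]
  refine pow_le_pow_left₀ (abs_nonneg _) ?_ 2
  rw [← one_div, le_div_iff₀ hε, ← abs_of_pos hε, ← abs_mul, mul_comm, abs_le]
  constructor <;> linarith [h.1, h.2]

theorem isFiniteMeasure_scaledDualCell (d : ℕ) (hε : 0 < ε) :
    IsFiniteMeasure ((volume : Measure (E d)).restrict (scaledDualCell d ε)) :=
  ⟨by simpa using volume_scaledDualCell_lt_top d hε⟩

theorem isFiniteMeasure_ball (d : ℕ) (R : ℝ) :
    IsFiniteMeasure ((volume : Measure (E d)).restrict (Metric.ball 0 R)) :=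
  ⟨by simpa using measure_ball_lt_top⟩

theorem IsBlochSystem.eLpNorm_mode (hB : IsBlochSystem A ρ lam φ) {η : E d}
    (hη : η ∈ dualCell d) (m : ℕ) : eLpNorm (fun y => φ m y η) 2 (cellMeasure d) = 1 := by
  have h := (hB.orthonormal_mode hη).1 m
  change ‖(hB.memH2 η hη m).memLp.toLp _‖ = 1 at h
  rw [Lp.norm_toLp] at h
  rwa [← ENNReal.toReal_eq_one_iff]

theorem IsBlochSystem.lintegral_scaledMode_sq_le (hB : IsBlochSystem A ρ lam φ) (hε : 0 < ε)
    (R : ℝ) {ξ : E d} (hξ : ε • ξ ∈ dualCell d) (m : ℕ) :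
    ∫⁻ x in Metric.ball 0 R, ‖scaledMode ε (φ m) x ξ‖ₑ ^ 2 ≤ ballConst d hε R := by
  have h := hB.memH2 _ hξ m
  have h1 := eLpNorm_comp_cellFract_le hε R h.memLp.1
  rw [hB.eLpNorm_mode hξ, mul_one] at h1
  have h2 := pow_le_pow_left₀ zero_le h1 2
  rw [eLpNorm_two_sq, ← ENNReal.rpow_natCast, ← ENNReal.rpow_mul] at h2
  refine le_trans (le_of_eq ?_) (h2.trans (by simp))
  refine lintegral_congr_ae ?_
  filter_upwards [ae_restrict_of_ae (h.ae_cellFract_smul_eq hε)] with x hx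
  rw [hx]
  rfl

theorem IsBlochSystem.memLp_scaledMode (hB : IsBlochSystem A ρ lam φ) (hε : 0 < ε) (R : ℝ)
    (m : ℕ) : MemLp (fun z : E d × E d => scaledMode ε (φ m) z.1 z.2) 2
      ((volume.restrict (Metric.ball 0 R)).prod (volume.restrict (scaledDualCell d ε))) := by
  have hm : AEStronglyMeasurable (fun z : E d × E d => scaledMode ε (φ m) z.1 z.2)
      ((volume.restrict (Metric.ball 0 R)).prod (volume.restrict (scaledDualCell d ε))) :=
    (hB.aestronglyMeasurable_scaledMode hε m).mono_measure
      (Measure.prod_mono Measure.restrict_le_self le_rfl)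
  refine ⟨hm, ?_⟩
  have h : eLpNorm (fun z : E d × E d => scaledMode ε (φ m) z.1 z.2) 2
      ((volume.restrict (Metric.ball 0 R)).prod (volume.restrict (scaledDualCell d ε))) ^ 2 ≤
      ballConst d hε R * volume (scaledDualCell d ε) := by
    rw [eLpNorm_two_sq, lintegral_prod_symm _ (hm.enorm.pow_const 2), ← setLIntegral_const]
    refine lintegral_mono_ae ?_
    filter_upwards [ae_mem_scaledDualCell d ε] with ξ hξ
    exact hB.lintegral_scaledMode_sq_le hε R hξ m
  have h2 := h.trans_lt
    (ENNReal.mul_lt_top (ballConst_ne_top d hε R).lt_top (volume_scaledDualCell_lt_top d hε))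
  rw [lt_top_iff_ne_top] at h2 ⊢
  exact fun h3 => h2 (by rw [h3]; simp)

/-- The integrand of the synthesis operator. -/
def synthKernel (ε : ℝ) (φ : E d → E d → ℂ) (B : E d → ℂ) (x ξ : E d) : ℂ :=
  B ξ * scaledMode ε φ x ξ * planeWave x ξ

/-- The contribution `∫ B(ξ) φ(x/ε; εξ) e^{i x · ξ} dξ` of a single mode. -/
def synth (ε : ℝ) (φ : E d → E d → ℂ) (B : E d → ℂ) (x : E d) : ℂ :=
  ∫ ξ in scaledDualCell d ε, synthKernel ε φ B x ξ

/-- The coefficient and the mode are both square integrable on ball times dual cell, a set of finite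
measure, and the plane wave is bounded. This justifies Fubini on each ball. -/
theorem IsBlochSystem.integrable_synthKernel (hB : IsBlochSystem A ρ lam φ) (hε : 0 < ε) (R : ℝ)
    (m : ℕ) {B : E d → ℂ} (hb : MemLp B 2 (volume.restrict (scaledDualCell d ε))) :
    Integrable (fun z : E d × E d => synthKernel ε (φ m) B z.1 z.2)
      ((volume.restrict (Metric.ball 0 R)).prod (volume.restrict (scaledDualCell d ε))) := by
  have := isFiniteMeasure_ball d R
  have := isFiniteMeasure_scaledDualCell d hε
  have h1 : MemLp (fun z : E d × E d => B z.2) 2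
      ((volume.restrict (Metric.ball 0 R)).prod (volume.restrict (scaledDualCell d ε))) :=
    hb.comp_snd _
  have h2 := h1.integrable_mul (hB.memLp_scaledMode hε R m)
  refine h2.mul_bdd (c := 1) continuous_planeWave.aestronglyMeasurable ?_
  exact Eventually.of_forall fun z => (norm_planeWave _ _).le

theorem ae_of_forall_ae_ball {p : E d → Prop}
    (h : ∀ R : ℕ, ∀ᵐ x ∂(volume.restrict (Metric.ball (0 : E d) R)), p x) : ∀ᵐ x, p x := by
  have h2 : ∀ R : ℕ, ∀ᵐ x, x ∈ Metric.ball (0 : E d) R → p x := fun R =>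
    (ae_restrict_iff' measurableSet_ball).mp (h R)
  filter_upwards [ae_all_iff.mpr h2] with x hx
  obtain ⟨R, hR⟩ := exists_nat_gt ‖x‖
  exact hx R (by simpa using hR)

theorem IsBlochSystem.ae_integrable_synthKernel (hB : IsBlochSystem A ρ lam φ) (hε : 0 < ε)
    (m : ℕ) {B : E d → ℂ} (hb : MemLp B 2 (volume.restrict (scaledDualCell d ε))) :
    ∀ᵐ x : E d, Integrable (synthKernel ε (φ m) B x)
      (volume.restrict (scaledDualCell d ε)) :=
  ae_of_forall_ae_ball fun R => (hB.integrable_synthKernel hε R m hb).prod_right_ae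

theorem IsBlochSystem.aestronglyMeasurable_synth (hB : IsBlochSystem A ρ lam φ) (hε : 0 < ε)
    (m : ℕ) {B : E d → ℂ} (hb : MemLp B 2 (volume.restrict (scaledDualCell d ε))) :
    AEStronglyMeasurable (synth ε (φ m) B) volume := by
  have h : AEStronglyMeasurable (fun z : E d × E d => synthKernel ε (φ m) B z.1 z.2)
      (volume.prod (volume.restrict (scaledDualCell d ε))) :=
    ((hb.1.comp_quasiMeasurePreserving Measure.quasiMeasurePreserving_snd).mul
      (hB.aestronglyMeasurable_scaledMode hε m)).mul
      continuous_planeWave.aestronglyMeasurable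
  exact h.integral_prod_right'

/-- Synthesis is adjoint to the Bloch coefficient. -/
theorem IsBlochSystem.integral_synth_mul_conj (hB : IsBlochSystem A ρ lam φ) (hε : 0 < ε) (R : ℝ)
    (m : ℕ) {B : E d → ℂ} (hb : MemLp B 2 (volume.restrict (scaledDualCell d ε))) (h : L2 d)
    {C : ℝ} (hC : ∀ᵐ x, ‖h x‖ ≤ C) :
    ∫ x in Metric.ball 0 R, synth ε (φ m) B x * conj (h x) =
      ∫ ξ in scaledDualCell d ε, B ξ * conj (blochCoeff ε (φ m) (truncate h R) ξ) := by
  have hi : Integrable (Function.uncurry fun x ξ : E d => synthKernel ε (φ m) B x ξ * conj (h x))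
      ((volume.restrict (Metric.ball 0 R)).prod (volume.restrict (scaledDualCell d ε))) := by
    refine (hB.integrable_synthKernel hε R m hb).mul_bdd (c := C) ?_ ?_
    · exact Complex.continuous_conj.comp_aestronglyMeasurable
        ((Lp.memLp h).1.restrict.comp_quasiMeasurePreserving Measure.quasiMeasurePreserving_fst)
    · refine Measure.quasiMeasurePreserving_fst.ae (p := fun x => ‖conj (h x)‖ ≤ C)
        (ae_restrict_of_ae ?_)
      simpa using hC
  simp only [synth, ← integral_mul_const]
  rw [integral_integral_swap hi]
  refine integral_congr_ae ?_
  filter_upwards [integral_ball_eq_blochCoeff hε (fun η hη => hB.memH2 η hη m) h R] with ξ hξ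
  rw [← hξ, ← integral_conj, ← integral_const_mul]
  refine integral_congr_ae (Eventually.of_forall fun x => ?_)
  simp only [synthKernel, map_mul, Complex.conj_conj]
  ring

/-! ### Contractivity of synthesis and convergence of the mode series. -/

theorem norm_truncate_le (u : L2 d) (R : ℝ) : ‖truncate u R‖ ≤ ‖u‖ := by
  rw [truncate, Lp.norm_toLp, Lp.norm_def]
  exact ENNReal.toReal_mono (Lp.memLp u).2.ne (eLpNorm_indicator_le _)

theorem ofReal_integral_norm_sq {X : Type*} [MeasurableSpace X] {μ : Measure X} {f : X → ℂ}
    (hf : MemLp f 2 μ) : ENNReal.ofReal (∫ x, ‖f x‖ ^ 2 ∂μ) = ∫⁻ x, ‖f x‖ₑ ^ 2 ∂μ := by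
  rw [ofReal_integral_eq_lintegral_ofReal ((memLp_two_iff_integrable_sq_norm hf.1).mp hf)
    (Eventually.of_forall fun x => by positivity)]
  simp only [enorm_sq_eq_ofReal]

theorem re_integral_mul_conj_le {X : Type*} [MeasurableSpace X] {μ : Measure X} {f g : X → ℂ}
    (hf : MemLp f 2 μ) (hg : MemLp g 2 μ) :
    (∫ x, f x * conj (g x) ∂μ).re ≤ (∫ x, ‖f x‖ ^ 2 ∂μ + ∫ x, ‖g x‖ ^ 2 ∂μ) / 2 := by
  have h1 := (memLp_two_iff_integrable_sq_norm hf.1).mp hf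
  have h2 := (memLp_two_iff_integrable_sq_norm hg.1).mp hg
  have h3 : Integrable (fun x => f x * conj (g x)) μ := hf.integrable_mul hg.star
  rw [← integral_add h1 h2, ← integral_div, ← RCLike.re_to_complex, ← integral_re h3]
  refine integral_mono h3.re ((h1.add h2).div_const 2) fun x => ?_
  simp only [RCLike.re_to_complex]
  refine (Complex.re_le_norm _).trans ?_
  rw [norm_mul, RCLike.norm_conj]
  nlinarith [sq_nonneg (‖f x‖ - ‖g x‖)]

theorem IsBlochSystem.memLp_blochCoeff (hB : IsBlochSystem A ρ lam φ) (hε : 0 < ε) (m : ℕ)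
    (u : L2 d) : MemLp (blochCoeff ε (φ m) u) 2 (volume.restrict (scaledDualCell d ε)) :=
  (hB.isBlochCoeff hε m u).1

/-- Bound for the `L²` norm of a finite sum of modes. -/
theorem IsBlochSystem.lintegral_sum_synth_sq_le (hB : IsBlochSystem A ρ lam φ) (hε : 0 < ε)
    {B : ℕ → E d → ℂ} (hb : ∀ m, MemLp (B m) 2 (volume.restrict (scaledDualCell d ε)))
    (s : Finset ℕ) :
    ∫⁻ x, ‖∑ m ∈ s, synth ε (φ m) (B m) x‖ₑ ^ 2 ≤
      ∑ m ∈ s, ∫⁻ ξ in scaledDualCell d ε, ‖B m ξ‖ₑ ^ 2 := by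
  have hSm : AEStronglyMeasurable (fun x => ∑ m ∈ s, synth ε (φ m) (B m) x) volume :=
    Finset.aestronglyMeasurable_fun_sum s fun m _ => hB.aestronglyMeasurable_synth hε m (hb m)
  set S := hSm.mk _ with hS
  have hSs : StronglyMeasurable S := hSm.stronglyMeasurable_mk
  have hSe : (fun x => ∑ m ∈ s, synth ε (φ m) (B m) x) =ᵐ[volume] S := hSm.ae_eq_mk
  have e0 : ∫⁻ x, ‖∑ m ∈ s, synth ε (φ m) (B m) x‖ₑ ^ 2 = ∫⁻ x, ‖S x‖ₑ ^ 2 :=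
    lintegral_congr_ae (by filter_upwards [hSe] with x hx; rw [hx])
  rw [e0]
  -- It is not yet known that `S` is square integrable. It is tested against its restriction to sets
  -- where both `x` and `S x` are bounded. These sets increase to the whole space, so a bound
  -- uniform in `r` suffices.
  set K : ℕ → Set (E d) := fun r => Metric.ball 0 r ∩ {x | ‖S x‖ ≤ r} with hK
  have mK : ∀ r, MeasurableSet (K r) := fun r =>
    measurableSet_ball.inter (measurableSet_le hSs.norm.measurable measurable_const)
  have hU : ⋃ r, K r = Set.univ := by
    refine Set.eq_univ_of_forall fun x => ?_
    obtain ⟨r, hr⟩ := exists_nat_gt (max ‖x‖ ‖S x‖)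
    refine Set.mem_iUnion.mpr ⟨r, ?_, ?_⟩
    · simpa using (le_max_left _ _).trans_lt hr
    · exact ((le_max_right _ _).trans_lt hr).le
  have hmono : Monotone K := by
    intro r t hrt x hx
    have h' : (r : ℝ) ≤ t := by exact_mod_cast hrt
    exact ⟨Metric.ball_subset_ball h' hx.1, le_trans hx.2 h'⟩
  rw [← setLIntegral_univ, ← hU, setLIntegral_iUnion_of_directed _ hmono.directed_le]
  refine iSup_le fun r => ?_
  have hhb : ∀ x, ‖(K r).indicator S x‖ ≤ r := by
    intro x
    by_cases hx : x ∈ K r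
    · rw [Set.indicator_of_mem hx]
      exact hx.2
    · rw [Set.indicator_of_notMem hx]
      simp
  have hh : MemLp ((K r).indicator S) 2 volume := by
    rw [memLp_indicator_iff_restrict (mK r)]
    have : IsFiniteMeasure ((volume : Measure (E d)).restrict (K r)) :=
      ⟨by simpa using (measure_mono Set.inter_subset_left).trans_lt measure_ball_lt_top⟩
    refine MemLp.of_bound hSs.aestronglyMeasurable r ?_
    filter_upwards [ae_restrict_mem (mK r)] with x hx
    exact hx.2
  set h : L2 d := hh.toLp _ with hh'
  have hC : ∀ᵐ x, ‖h x‖ ≤ r := by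
    filter_upwards [hh.coeFn_toLp] with x hx
    rw [hx]
    exact hhb x
  have hn : ∫⁻ x in K r, ‖S x‖ₑ ^ 2 = ENNReal.ofReal (‖h‖ ^ 2) := by
    rw [← lintegral_enorm_sq_Lp, ← lintegral_indicator (mK r)]
    refine lintegral_congr_ae ?_
    filter_upwards [hh.coeFn_toLp] with x hx
    rw [hx]
    by_cases hxk : x ∈ K r <;> simp [hxk]
  -- `h` equals `S` on `K r` and vanishes elsewhere, so pairing the sum of modes with `h` returns
  -- `‖h‖²`. Adjointness then rewrites it in terms of the coefficients of `h`.
  have hpair : ∑ m ∈ s, ∫ x in Metric.ball 0 (r : ℝ), synth ε (φ m) (B m) x * conj (h x) =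
      ((‖h‖ ^ 2 : ℝ) : ℂ) := by
    have hint : ∀ m ∈ s, Integrable (fun x => synth ε (φ m) (B m) x * conj (h x))
        (volume.restrict (Metric.ball 0 (r : ℝ))) := by
      intro m _
      have := isFiniteMeasure_scaledDualCell d hε
      have h1 : Integrable (synth ε (φ m) (B m)) (volume.restrict (Metric.ball 0 (r : ℝ))) :=
        (hB.integrable_synthKernel hε r m (hb m)).integral_prod_left
      refine h1.mul_bdd (c := r) (Complex.continuous_conj.comp_aestronglyMeasurable
        (Lp.memLp h).1.restrict) (ae_restrict_of_ae ?_)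
      simpa using hC
    rw [← integral_finsetSum _ hint]
    have e1 : ∫ x in Metric.ball 0 (r : ℝ), ∑ m ∈ s, synth ε (φ m) (B m) x * conj (h x) =
        ∫ x, h x * conj (h x) := by
      rw [← integral_indicator measurableSet_ball]
      refine integral_congr_ae ?_
      filter_upwards [hSe, hh.coeFn_toLp] with x h1 h2
      by_cases hxb : x ∈ Metric.ball (0 : E d) (r : ℝ)
      · rw [Set.indicator_of_mem hxb, ← Finset.sum_mul, h1, h2]
        by_cases hxk : x ∈ K r <;> simp [hxk]
      · have hxk : x ∉ K r := fun h => hxb h.1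
        rw [Set.indicator_of_notMem hxb, h2]
        simp [hxk]
    have e2 : inner ℂ h h = ∫ x, h x * conj (h x) := by
      rw [L2.inner_def]
      rfl
    rw [e1, ← e2, inner_self_eq_norm_sq_to_K]
    push_cast
    rfl
  simp only [hB.integral_synth_mul_conj hε r _ (hb _) h hC] at hpair
  have hre := congrArg Complex.re hpair
  rw [Complex.ofReal_re, Complex.re_sum] at hre
  set b := fun m => blochCoeff ε (φ m) (truncate h r) with hbdef
  have hbm : ∀ m, MemLp (b m) 2 (volume.restrict (scaledDualCell d ε)) := fun m =>
    hB.memLp_blochCoeff hε m _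
  have hbess : ∑ m ∈ s, ∫ ξ in scaledDualCell d ε, ‖b m ξ‖ ^ 2 ≤ ‖h‖ ^ 2 := by
    have h1 := hB.sum_lintegral_blochCoeff_sq_le hε s (truncate h r)
    have h2 : ∀ m ∈ s, ∫⁻ ξ in scaledDualCell d ε, ‖blochCoeff ε (φ m) (truncate h r) ξ‖ₑ ^ 2 =
        ENNReal.ofReal (∫ ξ in scaledDualCell d ε, ‖b m ξ‖ ^ 2) := fun m _ =>
      (ofReal_integral_norm_sq (hbm m)).symm
    rw [Finset.sum_congr rfl h2, ← ENNReal.ofReal_sum_of_nonneg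
      fun m _ => integral_nonneg fun ξ => by positivity, ENNReal.ofReal_le_ofReal_iff
      (by positivity)] at h1
    exact h1.trans (pow_le_pow_left₀ (norm_nonneg _) (norm_truncate_le h r) 2)
  -- Young's inequality leaves half of the sum of the `‖b m‖²`, which Bessel bounds by `‖h‖² / 2`.
  -- This is absorbed on the left.
  have hle : ‖h‖ ^ 2 ≤ ((∑ m ∈ s, ∫ ξ in scaledDualCell d ε, ‖B m ξ‖ ^ 2) +
      ∑ m ∈ s, ∫ ξ in scaledDualCell d ε, ‖b m ξ‖ ^ 2) / 2 := by
    rw [← hre, ← Finset.sum_add_distrib, Finset.sum_div]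
    exact Finset.sum_le_sum fun m _ => re_integral_mul_conj_le (hb m) (hbm m)
  have h3 : ‖h‖ ^ 2 ≤ ∑ m ∈ s, ∫ ξ in scaledDualCell d ε, ‖B m ξ‖ ^ 2 := by linarith
  rw [hn]
  refine (ENNReal.ofReal_le_ofReal h3).trans (le_of_eq ?_)
  rw [ENNReal.ofReal_sum_of_nonneg fun m _ => integral_nonneg fun ξ => by positivity]
  exact Finset.sum_congr rfl fun m _ => ofReal_integral_norm_sq (hb m)

theorem IsBlochSystem.memLp_synth (hB : IsBlochSystem A ρ lam φ) (hε : 0 < ε) (m : ℕ)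
    {B : ℕ → E d → ℂ} (hb : ∀ m, MemLp (B m) 2 (volume.restrict (scaledDualCell d ε))) :
    MemLp (synth ε (φ m) (B m)) 2 volume := by
  refine ⟨hB.aestronglyMeasurable_synth hε m (hb m), ?_⟩
  have h := hB.lintegral_sum_synth_sq_le hε hb {m}
  simp only [Finset.sum_singleton] at h
  rw [← eLpNorm_two_sq, ← eLpNorm_two_sq] at h
  exact ((ENNReal.pow_le_pow_left_iff two_ne_zero).mp h).trans_lt (hb m).2

/-- The contribution of a single mode as an element of `L²(ℝ^d)`. -/
def IsBlochSystem.synthLp (hB : IsBlochSystem A ρ lam φ) (hε : 0 < ε)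
    {B : ℕ → E d → ℂ} (hb : ∀ m, MemLp (B m) 2 (volume.restrict (scaledDualCell d ε))) (m : ℕ) :
    L2 d := (hB.memLp_synth hε m hb).toLp _

theorem IsBlochSystem.coeFn_sum_synthLp (hB : IsBlochSystem A ρ lam φ) (hε : 0 < ε)
    {B : ℕ → E d → ℂ} (hb : ∀ m, MemLp (B m) 2 (volume.restrict (scaledDualCell d ε)))
    (s : Finset ℕ) :
    ⇑(∑ m ∈ s, hB.synthLp hε hb m) =ᵐ[volume] fun x => ∑ m ∈ s, synth ε (φ m) (B m) x := by
  classical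
  induction s using Finset.induction_on with
  | empty =>
    simp only [Finset.sum_empty]
    exact Lp.coeFn_zero _ _ _
  | insert m s hm ih =>
    simp only [Finset.sum_insert hm]
    filter_upwards [Lp.coeFn_add (hB.synthLp hε hb m) (∑ m ∈ s, hB.synthLp hε hb m), ih,
      (hB.memLp_synth hε m hb).coeFn_toLp] with x h1 h2 h3
    rw [h1, Pi.add_apply, h2, synthLp, h3]

theorem IsBlochSystem.enorm_sum_synthLp_sq_le (hB : IsBlochSystem A ρ lam φ) (hε : 0 < ε)
    {B : ℕ → E d → ℂ} (hb : ∀ m, MemLp (B m) 2 (volume.restrict (scaledDualCell d ε)))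
    (s : Finset ℕ) :
    ‖∑ m ∈ s, hB.synthLp hε hb m‖ₑ ^ 2 ≤
      ∑ m ∈ s, ∫⁻ ξ in scaledDualCell d ε, ‖B m ξ‖ₑ ^ 2 := by
  refine le_trans (le_of_eq ?_) (hB.lintegral_sum_synth_sq_le hε hb s)
  rw [enorm_sq_eq_ofReal, ← lintegral_enorm_sq_Lp]
  refine lintegral_congr_ae ?_
  filter_upwards [hB.coeFn_sum_synthLp hε hb s] with x hx
  rw [hx]

/-- Cauchy's criterion over finite sets of modes: the contraction bound reduces it to the vanishing
of tails of the coefficient series. -/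
theorem IsBlochSystem.summable_synthLp (hB : IsBlochSystem A ρ lam φ) (hε : 0 < ε)
    {B : ℕ → E d → ℂ} (hb : ∀ m, MemLp (B m) 2 (volume.restrict (scaledDualCell d ε)))
    (hs : ∑' m, ∫⁻ ξ in scaledDualCell d ε, ‖B m ξ‖ₑ ^ 2 ≠ ⊤) :
    Summable (hB.synthLp hε hb) := by
  rw [summable_iff_vanishing_norm]
  intro δ hδ
  have hsum := ENNReal.summable_toReal hs
  have hfin := ENNReal.ne_top_of_tsum_ne_top hs
  rw [summable_iff_vanishing_norm] at hsum
  obtain ⟨s, hs'⟩ := hsum (δ ^ 2) (by positivity)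
  refine ⟨s, fun t ht => ?_⟩
  have h1 := hs' t ht
  have h2 := hB.enorm_sum_synthLp_sq_le hε hb t
  rw [← ENNReal.toReal_sum fun m _ => hfin m, Real.norm_eq_abs,
    abs_of_nonneg ENNReal.toReal_nonneg] at h1
  have h3 := ENNReal.toReal_mono (ENNReal.sum_ne_top.mpr fun m _ => hfin m) h2
  rw [ENNReal.toReal_pow, toReal_enorm] at h3
  exact lt_of_pow_lt_pow_left₀ 2 hδ.le (h3.trans_lt h1)

/-- If all partial sums of the contributions of the higher modes are bounded, the series converges
and its sum satisfies the same bound. -/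
theorem IsBlochSystem.exists_isHigherModePart (hB : IsBlochSystem A ρ lam φ) (hε : 0 < ε)
    {B : ℕ → E d → ℂ} (hb : ∀ m, MemLp (B m) 2 (volume.restrict (scaledDualCell d ε)))
    (hs : ∑' m, ∫⁻ ξ in scaledDualCell d ε, ‖B m ξ‖ₑ ^ 2 ≠ ⊤) {C : ℝ} (hC : 0 ≤ C)
    (hle : ∀ N : ℕ, ∑ m ∈ Finset.Icc 1 N, ∫⁻ ξ in scaledDualCell d ε, ‖B m ξ‖ₑ ^ 2 ≤
      ENNReal.ofReal (C ^ 2)) :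
    ∃ v : L2 d, IsHigherModePart ε φ B v ∧ ‖v‖ ≤ C := by
  set f := hB.synthLp hε hb with hf
  have hsum : Summable fun m => f (m + 1) :=
    (summable_nat_add_iff 1).mpr (hB.summable_synthLp hε hb hs)
  -- Modes are numbered from `0` and the first is omitted, hence the shift by one.
  have hrange : ∀ N : ℕ, ∑ m ∈ Finset.range N, f (m + 1) = ∑ m ∈ Finset.Icc 1 N, f m := by
    intro N
    induction N with
    | zero => simp
    | succ N ih => rw [Finset.sum_range_succ, ih, Finset.sum_Icc_succ_top (by omega)]
  have hT : Tendsto (fun N => ∑ m ∈ Finset.Icc 1 N, f m) atTop (𝓝 (∑' m, f (m + 1))) := by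
    simpa only [hrange] using hsum.hasSum.tendsto_sum_nat
  refine ⟨∑' m, f (m + 1), ?_, ?_⟩
  · unfold IsHigherModePart
    have h := (tendsto_iff_norm_sub_tendsto_zero.mp hT)
    have h2 := ENNReal.tendsto_ofReal h
    rw [ENNReal.ofReal_zero] at h2
    refine h2.congr fun N => ?_
    rw [ofReal_norm, Lp.enorm_def]
    refine eLpNorm_congr_ae ?_
    filter_upwards [Lp.coeFn_sub (∑ m ∈ Finset.Icc 1 N, f m) (∑' m, f (m + 1)),
      hB.coeFn_sum_synthLp hε hb (Finset.Icc 1 N),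
      ae_all_iff.mpr fun m => hB.ae_integrable_synthKernel hε m (hb m)] with x h3 h4 h5
    rw [h3, Pi.sub_apply, hf, h4]
    congr 1
    -- The sum stands inside the integral in `IsHigherModePart`. The exchange requires each kernel
    -- to be integrable, which holds for almost every `x`.
    exact (integral_finsetSum _ fun m _ => h5 m).symm
  · refine le_of_tendsto hT.norm (Eventually.of_forall fun N => ?_)
    have h := (hB.enorm_sum_synthLp_sq_le hε hb (Finset.Icc 1 N)).trans (hle N)
    rw [enorm_sq_eq_ofReal, ENNReal.ofReal_le_ofReal_iff (by positivity)] at h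
    exact (pow_le_pow_iff_left₀ (norm_nonneg _) hC two_ne_zero).mp h

end Synthesis

end

end BlochHom

/-! ### The estimate for the higher modes. -/

theorem proposition8p1 (d : ℕ) (α β M : ℝ) :
    ∃ c : ℝ, 0 < c ∧
      ∀ A : BlochHom.E d → Matrix (Fin d) (Fin d) ℝ, BlochHom.IsAdmissible α β A →
      ∀ ε κ : ℝ, 0 < ε → 0 < κ →
      ∀ (lam : ℕ → BlochHom.E d → ℝ) (φ : ℕ → BlochHom.E d → BlochHom.E d → ℂ),
        BlochHom.IsBlochSystem A (κ / ε) lam φ →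
      ∀ f u : BlochHom.L2 d, BlochHom.IsSolution A κ ε f u →
      ∀ (G : Fin d → BlochHom.L2 d) (L : BlochHom.L2 d),
        (∀ j, BlochHom.IsPartial j u (G j)) → BlochHom.IsLaplacian u L →
        ‖u‖ ^ 2 + ∑ j, ‖G j‖ ^ 2 ≤ M ^ 2 → κ * ‖L‖ ≤ M →
      ∃ (B : ℕ → BlochHom.E d → ℂ) (v : BlochHom.L2 d),
        (∀ m, BlochHom.IsBlochCoeff ε (φ m) u (B m)) ∧
        BlochHom.IsHigherModePart ε φ B v ∧
        ‖v‖ ≤ c * ε := by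
  -- `4/α` comes from the spectral gap, `|β| d` from the gradient term, and the inner `1` from
  -- `κ‖Δu‖ ≤ M`. The outer `+ 1` makes the constant positive even if `M = 0`, and does so before `α
  -- > 0` is available from `A`.
  refine ⟨Real.sqrt (4 / α * ((|β| * d + 1) * M ^ 2)) + 1, by positivity, ?_⟩
  intro A hA ε κ hε hκ lam φ hB f u _ G L hG hL hM hκL
  have hα := hA.pos
  set c := Real.sqrt (4 / α * ((|β| * d + 1) * M ^ 2)) with hc
  have hc2 : c ^ 2 = 4 / α * ((|β| * d + 1) * M ^ 2) := Real.sq_sqrt (by positivity)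
  have hc0 : 0 ≤ c := Real.sqrt_nonneg _
  -- Bessel's inequality bounds every finite partial sum by `‖u‖²`. This gives convergence; the size
  -- `c * ε` comes from the energy bound in `hle`.
  have hs : ∑' m, ∫⁻ ξ in BlochHom.scaledDualCell d ε,
      ‖BlochHom.blochCoeff ε (φ m) u ξ‖ₑ ^ 2 ≠ ⊤ := by
    refine ne_top_of_le_ne_top (ENNReal.ofReal_ne_top (r := ‖u‖ ^ 2)) ?_
    rw [ENNReal.tsum_eq_iSup_sum]
    exact iSup_le fun s => hB.sum_lintegral_blochCoeff_sq_le hε s u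
  have hle : ∀ N : ℕ, ∑ m ∈ Finset.Icc 1 N, ∫⁻ ξ in BlochHom.scaledDualCell d ε,
      ‖BlochHom.blochCoeff ε (φ m) u ξ‖ₑ ^ 2 ≤ ENNReal.ofReal ((c * ε) ^ 2) := by
    intro N
    refine (hB.sum_lintegral_blochCoeff_Icc_le hA hε hG hL N).trans (ENNReal.ofReal_le_ofReal ?_)
    have h1 : ∑ j, ‖G j‖ ^ 2 ≤ M ^ 2 := by linarith [sq_nonneg ‖u‖]
    have h2 : κ ^ 2 * ‖L‖ ^ 2 ≤ M ^ 2 := by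
      rw [← mul_pow]
      exact pow_le_pow_left₀ (by positivity) hκL 2
    rw [mul_pow, hc2]
    have h3 : |β| * d * ∑ j, ‖G j‖ ^ 2 + κ ^ 2 * ‖L‖ ^ 2 ≤ (|β| * d + 1) * M ^ 2 := by
      rw [add_mul, one_mul]
      exact add_le_add (mul_le_mul_of_nonneg_left h1 (by positivity)) h2
    calc 4 / α * ε ^ 2 * (|β| * d * ∑ j, ‖G j‖ ^ 2 + κ ^ 2 * ‖L‖ ^ 2)
        ≤ 4 / α * ε ^ 2 * ((|β| * d + 1) * M ^ 2) :=
          mul_le_mul_of_nonneg_left h3 (by positivity)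
      _ = 4 / α * ((|β| * d + 1) * M ^ 2) * ε ^ 2 := by ring
  obtain ⟨v, hv, hvn⟩ := hB.exists_isHigherModePart hε
    (fun m => hB.memLp_blochCoeff hε m u) hs (by positivity) hle
  refine ⟨fun m => BlochHom.blochCoeff ε (φ m) u, v, fun m => hB.isBlochCoeff hε m u, hv,
    hvn.trans ?_⟩
  exact mul_le_mul_of_nonneg_right (by linarith) hε.le
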